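/- Let $\mathcal M$ be a matroid of rank $r\ge 1$ on a finite set $E$ with rank function $\mathrm{rk}$, and let $a(e)>0$ ($e\in E$) be acquisition costs, $a_{\max}=\max_e a(e)$, $a_{\min}=\min_e a(e)$. Let $c_t(e)\in[0,\infty]$ be holding costs for $t=1,\dots,T$. In multistage spanning set maintenance (MSM) one must choose spanning sets $S_1,\dots,S_T$ of $\mathcal M$ (with $S_0=\emptyset$); the cost is $\sum_{t=1}^T\big(\sum_{e\in S_t}c_t(e)+\sum_{e\in S_t\setminus S_{t-1}}a(e)\big)$. A fractional solution consists of vectors $z_t,y_t\in\mathbb R_{\ge0}^E$ for $1\le t\le T$, with $z_0=0$, such that $z_t$ lies in the base polytope $\{x\ge 0: \sum_{e\in S}x_e\le \mathrm{rk}(S)\ \forall S\subseteq E,\ \sum_{e\in E} x_e=r\}$ and $y_t(e)\ge z_t(e)-z_{t-1}(e)$; its value is $\mathrm{LP}(y,z)=\sum_{t,e}\big(a(e)y_t(e)+c_t(e)z_t(e)\big)$. Put $R=8r\,a_{\max}/a_{\min}$ and $L'=64\log R$ (natural logarithm). Consider the following randomized rounding algorithm. Time is split into consecutive epochs: an epoch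 that starts at time $p$ ends at the first time $q\ge p$ with $\sum_{t=p}^{q}\sum_e a(e)y_t(e)\ge r\,a_{\max}$, and the next epoch starts at time $q+1$. At every time $t$ the algorithm holds thresholds $(\tau_e)_{e\in E}$ and outputs $S_t=\{e: z_t(e)\ge\tau_e\}$. At the start of each epoch, and whenever the set $\{e: z_t(e)\ge \tau_e\}$ given by the current thresholds is not spanning, all thresholds are redrawn independently and uniformly from $[0,1/L']$, and this is repeated until the set obtained at time $t$ is spanning. This algorithm is online: its output at time $t$ depends only on $\mathcal M$, $a$, the vectors $y_s,z_s$ with $s\le t$, and the random draws made at times $s\le t$. Moreover there is a universal constant $C>0$ such that for every instance and every fractional solution $(y,z)$: 1. the events $\{e\in S_t\}$ are measurable, and almost surely every $S_t$, $1\le t\le T$, is spanning; 2. the expected cost of $(S_t)$ is at most $C\log R\cdot\mathrm{LP}(y,z)$, and, if $r\,a_{\max}/a_{\min}\ge2$, at most $C\log(r\,a_{\max}/a_{\min})\cdot \mathrm{LP}(y,z)$; 3. if all acquisition costs are equal and $r\ge 2$, the expected cost is at most $C\log r\cdot\mathrm{LP}(y,z)$; 4. if $\alpha\in[0,\infty]$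 and $\mathrm{LP}(y,z)\le\alpha\,\mathrm{LP}(y',z')$ for all fractional solutions $(y',z')$ (for example $\alpha=1$ and $(y,z)$ optimal, in the offline problem), then the expected cost is at most $C\,\alpha\log R$ times the cost of any MSM solution. -/

import Mathlib

open MeasureTheory
open scoped ENNReal

noncomputable section

namespace Multistage

variable {E : Type*} [Fintype E]

/-- Rank of a set in a matroid on a finite type, as a natural number. -/
def rankOf (M : Matroid E) (X : Set E) : ℕ := (M.eRk X).toNat

/-- Rank of the matroid. -/
def rankM (M : Matroid E) : ℕ := M.eRank.toNat

/-- The base polytope: `x ≥ 0`, `x(S) ≤ rank S` for all `S ⊆ E`, and `x(E) = rank E`. -/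
def basePolytope (M : Matroid E) : Set (E → ℝ) :=
  {x | (∀ e, 0 ≤ x e) ∧ (∀ S : Finset E, ∑ e ∈ S, x e ≤ (rankOf M (S : Set E) : ℝ)) ∧
    ∑ e, x e = (rankM M : ℝ)}

/-- Feasibility for the linear programming relaxation over timesteps `1, …, T`; the vector `z 0`
is the (empty) starting solution. -/
structure IsFractional (M : Matroid E) (T : ℕ) (y z : ℕ → E → ℝ) : Prop where
  z_zero : z 0 = 0
  z_mem : ∀ t ∈ Finset.Icc 1 T, z t ∈ basePolytope M
  y_nonneg : ∀ t ∈ Finset.Icc 1 T, ∀ e, 0 ≤ y t e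
  y_ge : ∀ t ∈ Finset.Icc 1 T, ∀ e, z t e - z (t - 1) e ≤ y t e

/-- The LP objective `∑_{t,e} a(e) y_t(e) + ∑_{t,e} c_t(e) z_t(e)`. Holding costs may be infinite
(with `∞ · 0 = 0`), so that elements available only during an interval are covered. -/
def lpCost (a : E → ℝ) (c : ℕ → E → ℝ≥0∞) (T : ℕ) (y z : ℕ → E → ℝ) : ℝ≥0∞ :=
  ∑ t ∈ Finset.Icc 1 T, ∑ e, ENNReal.ofReal (a e * y t e) +
    ∑ t ∈ Finset.Icc 1 T, ∑ e, c t e * ENNReal.ofReal (z t e)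

/-- A solution to multistage spanning set maintenance over timesteps `1, …, T`, with `S_0 = ∅`. -/
def IsMSM (M : Matroid E) (T : ℕ) (S : ℕ → Set E) : Prop :=
  S 0 = ∅ ∧ ∀ t ∈ Finset.Icc 1 T, M.Spanning (S t)

open scoped Classical in
/-- The cost `∑_t (c_t(S_t) + a(S_t \ S_{t-1}))`. -/
def msmCost (a : E → ℝ) (c : ℕ → E → ℝ≥0∞) (T : ℕ) (S : ℕ → Set E) : ℝ≥0∞ :=
  ∑ t ∈ Finset.Icc 1 T,
    (∑ e, (if e ∈ S t then c t e else 0) +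
      ∑ e, (if e ∈ S t \ S (t - 1) then ENNReal.ofReal (a e) else 0))

/-- `a_max`. -/
def aMax (a : E → ℝ) : ℝ := ⨆ e, a e

/-- `a_min`. -/
def aMin (a : E → ℝ) : ℝ := ⨅ e, a e

/-- `ρ = r · a_max / a_min`. -/
def rho (M : Matroid E) (a : E → ℝ) : ℝ := rankM M * aMax a / aMin a

/-- `R = 8 r a_max / a_min`. -/
def bigR (M : Matroid E) (a : E → ℝ) : ℝ := 8 * rankM M * aMax a / aMin a

/-- `L' = 64 log R`. -/
def bigL (M : Matroid E) (a : E → ℝ) : ℝ := 64 * Real.log (bigR M a)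

/-- The fractional acquisition cost paid in the current epoch up to and including time `t`.
An epoch is complete as soon as this is at least `r · a_max`; the next one starts from zero. -/
def epochCost (M : Matroid E) (a : E → ℝ) (y : ℕ → E → ℝ) : ℕ → ℝ
  | 0 => 0
  | t + 1 =>
    (if rankM M * aMax a ≤ epochCost M a y t then 0 else epochCost M a y t) + ∑ e, a e * y (t + 1) e

/-- Timestep `t ≥ 1` is the first timestep of an epoch. -/
def EpochStart (M : Matroid E) (a : E → ℝ) (y : ℕ → E → ℝ) (t : ℕ) : Prop :=
  t = 1 ∨ rankM M * aMax a ≤ epochCost M a y (t - 1)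

/-- The source of randomness: independent uniform numbers in `[0,1]`, one for each timestep `t`,
each attempt `k` at that timestep, and each element `e`. -/
abbrev Seed (E : Type*) : Type _ := ℕ × ℕ × E → unitInterval

/-- The law of the seed. -/
def seedLaw (E : Type*) : Measure (Seed E) :=
  Measure.infinitePi fun _ => (volume : Measure unitInterval)

/-- The `k`-th fresh vector of thresholds at time `t`: independent, uniform on `[0, 1/L]`. -/
def freshThresholds (L : ℝ) (ω : Seed E) (t k : ℕ) : E → ℝ := fun e => (ω (t, k, e) : ℝ) / L

/-- Threshold rounding of a fractional vector: `{e | x(e) ≥ τ(e)}`. -/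
def roundAt (x τ : E → ℝ) : Set E := {e | τ e ≤ x e}

open scoped Classical in
/-- The thresholds in force at time `t`. The old thresholds are kept if no new epoch starts and they
still give a spanning set. Otherwise all thresholds are drawn afresh, repeatedly, until they
give a spanning set. (The value at `0` is never used, since an epoch starts at time `1`.) -/
def thresholds (M : Matroid E) (a : E → ℝ) (y z : ℕ → E → ℝ) (ω : Seed E) : ℕ → E → ℝ
  | 0 => 0
  | t + 1 =>
    if ¬ EpochStart M a y (t + 1) ∧ M.Spanning (roundAt (z (t + 1)) (thresholds M a y z ω t)) then
      thresholds M a y z ω t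
    else
      freshThresholds (bigL M a) ω (t + 1)
        (sInf {k | M.Spanning (roundAt (z (t + 1)) (freshThresholds (bigL M a) ω (t + 1) k))})

/-- The random set maintained by the rounding algorithm at time `t`. -/
def rounding (M : Matroid E) (a : E → ℝ) (y z : ℕ → E → ℝ) (ω : Seed E) (t : ℕ) : Set E :=
  if t = 0 then ∅ else roundAt (z t) (thresholds M a y z ω t)

/-- The expected cost of the rounding algorithm. -/
def expectedCost (M : Matroid E) (a : E → ℝ) (c : ℕ → E → ℝ≥0∞) (T : ℕ) (y z : ℕ → E → ℝ) :
    ℝ≥0∞ :=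
  ∫⁻ ω, msmCost a c T (rounding M a y z ω) ∂(seedLaw E)

end Multistage

end

/-!
The rounding keeps one vector of thresholds for as long as possible, so its cost is governed by the
number of attempts, i.e. of fresh threshold vectors that it considers. The key point is that an
epoch has at most two attempts in expectation.

*One vector is rounded well.* Let `w ≥ 0` lie below the rank function and have total mass at least
`r - 1/2`. Outside of a flat of rank `k < r`, it has mass at least `(r - k) / 2`. If every element
`e` arrives at an exponential time with rate `w e`, the expected rank deficiency of the set of
present elements therefore satisfies `G' ≤ -G / 2`, and is at most `r * exp (-L'/2) = r * R ^ (-32)`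
at time `L'` (`sum_bernoulliWeight_not_spanning_le`). The thresholds select a larger set, since
`1 - exp (-L' * w e) ≤ L' * w e`, so it is spanning with high probability
(`seedLaw_not_spanning_le`).

*A whole epoch is rounded well.* An epoch may have arbitrarily many timesteps, but its fractional
acquisition cost is less than `r * a_max` before its last timestep. Hence its timesteps fall into at
most `R` groups within which the fractional solution moves by at most `1/2`; as all vectors have
coordinate sum `r`, the decreases are bounded by the increases. All vectors of a group thus lie
above one vector `w` as before (`exists_common_lower_bound`), and one fresh threshold vector works
for all timesteps of the epoch with probability at least `1 - 1/R`
(`seedLaw_exists_not_spanning_le`).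

*Attempts.* Whether a fresh vector is considered depends only on earlier draws, so it is independent
of this vector. Every attempt other than the first one of an epoch is caused by the failure of an
earlier attempt within the epoch. For the expected number `N` of attempts in an epoch this gives
`N ≤ 1 + N / R`, so `N ≤ 2`, and the attempts other than the first are at most `2 / R` in
expectation (`sum_expectedAttempts_le`, `sum_extraAttempts_le`).

*Cost.* By the same independence, `e` is held at time `t` with probability at most
`2 * L' * z_t(e)`, and it is acquired without a redraw with probability at most `2 * L' * y_t(e)`.
The redraws of one epoch cost at most `2 * L' * r * a_max` in expectation, which is paid for by the
previous, completed epoch. In the first epoch, the first attempt is paid for by the acquisitions at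
time `1`; these cost at least `r * a_min`, which also pays for the unlikely further attempts. In
total the loss is at most `6 * L'` (`expectedCost_le`).

The bound relative to integral solutions follows since the linear program is a relaxation
(`exists_fractional_lpCost_le`).
-/

noncomputable section

namespace Multistage

/-! ### Random subsets with independent elements -/

section Sampling

open scoped Classical in
/-- The probability that a random subset of `E` equals `S`, when each `e` is left out
independently with probability `q e`. -/
def bernoulliWeight {E : Type*} [Fintype E] (q : E → ℝ) (S : Finset E) : ℝ :=
  ∏ e, if e ∈ S then 1 - q e else q e

variable {E : Type*} [Fintype E]

lemma bernoulliWeight_nonneg {q : E → ℝ} (h0 : ∀ e, 0 ≤ q e) (h1 : ∀ e, q e ≤ 1)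
    (S : Finset E) : 0 ≤ bernoulliWeight q S := by
  refine Finset.prod_nonneg fun e _ => ?_
  split_ifs
  · linarith [h1 e]
  · exact h0 e

open scoped Classical in
lemma sum_finset_pivot (e : E) (h : Finset E → ℝ) :
    ∑ S, h S = ∑ S ∈ (Finset.univ.erase e).powerset, (h S + h (insert e S)) := by
  rw [Finset.sum_add_distrib, ← Finset.sum_powerset_insert (Finset.notMem_erase e _),
    Finset.insert_erase (Finset.mem_univ e), Finset.powerset_univ]

open scoped Classical in
/-- When each `e` is present at time `s` with probability `1 - exp (-s * w e)`, the expected value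
of `f` of the present set changes at the rate at which newly arriving elements change `f`. -/
lemma hasDerivAt_sum_bernoulliWeight (w : E → ℝ) (f : Finset E → ℝ) (s : ℝ) :
    HasDerivAt (fun s => ∑ S, bernoulliWeight (fun e => Real.exp (-s * w e)) S * f S)
      (∑ S, bernoulliWeight (fun e => Real.exp (-s * w e)) S *
        ∑ e, w e * (f (insert e S) - f S)) s := by
  have hq : ∀ e, HasDerivAt (fun s => Real.exp (-s * w e)) (-(w e * Real.exp (-s * w e))) s := by
    intro e
    have h := ((hasDerivAt_id s).neg.mul_const (w e)).exp
    simp only [id, Pi.neg_apply] at h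
    convert h using 1
    ring
  have hfac : ∀ (S : Finset E) (e : E),
      HasDerivAt (fun s => if e ∈ S then 1 - Real.exp (-s * w e) else Real.exp (-s * w e))
        (if e ∈ S then w e * Real.exp (-s * w e) else -(w e * Real.exp (-s * w e))) s := by
    intro S e
    split_ifs
    · simpa using (hq e).const_sub 1
    · exact hq e
  have hmain : HasDerivAt (fun s => ∑ S, bernoulliWeight (fun e => Real.exp (-s * w e)) S * f S)
      (∑ S : Finset E, (∑ e, (∏ j ∈ Finset.univ.erase e,
        if j ∈ S then 1 - Real.exp (-s * w j) else Real.exp (-s * w j)) •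
        (if e ∈ S then w e * Real.exp (-s * w e) else -(w e * Real.exp (-s * w e)))) * f S) s := by
    refine HasDerivAt.fun_sum fun S _ => HasDerivAt.mul_const ?_ _
    exact HasDerivAt.fun_finsetProd fun e _ => hfac S e
  convert hmain using 1
  simp only [Finset.sum_mul, Finset.mul_sum]
  rw [Finset.sum_comm]
  conv_rhs => rw [Finset.sum_comm]
  refine Finset.sum_congr rfl fun e _ => ?_
  rw [sum_finset_pivot e, sum_finset_pivot e]
  refine Finset.sum_congr rfl fun S hS => ?_
  have heS : e ∉ S := fun h => by simpa using Finset.mem_powerset.1 hS h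
  have hP : ∏ j ∈ Finset.univ.erase e, (if j ∈ insert e S then 1 - Real.exp (-s * w j)
        else Real.exp (-s * w j)) = ∏ j ∈ Finset.univ.erase e,
        (if j ∈ S then 1 - Real.exp (-s * w j) else Real.exp (-s * w j)) := by
    refine Finset.prod_congr rfl fun j hj => ?_
    simp [Finset.mem_insert, (Finset.mem_erase.1 hj).1]
  have hW : bernoulliWeight (fun e => Real.exp (-s * w e)) S = Real.exp (-s * w e) *
      ∏ j ∈ Finset.univ.erase e,
        (if j ∈ S then 1 - Real.exp (-s * w j) else Real.exp (-s * w j)) := by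
    rw [bernoulliWeight, ← Finset.mul_prod_erase _ _ (Finset.mem_univ e), if_neg heS]
  rw [hP, hW]
  simp only [Finset.insert_idem, Finset.mem_insert_self, heS, if_true, if_false, smul_eq_mul]
  ring

open scoped Classical in
/-- If arriving elements decrease `f` at least at rate `f / 2`, then the expected value of `f`
decays exponentially. -/
lemma sum_bernoulliWeight_le_exp {w : E → ℝ} (hw : ∀ e, 0 ≤ w e) {f : Finset E → ℝ}
    (hf : ∀ S, f S / 2 ≤ ∑ e, w e * (f S - f (insert e S))) {s : ℝ} (hs : 0 ≤ s) :
    ∑ S, bernoulliWeight (fun e => Real.exp (-s * w e)) S * f S ≤ f ∅ * Real.exp (-s / 2) := by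
  set G : ℝ → ℝ := fun s => ∑ S, bernoulliWeight (fun e => Real.exp (-s * w e)) S * f S with hG
  set G' : ℝ → ℝ := fun s => ∑ S, bernoulliWeight (fun e => Real.exp (-s * w e)) S *
        ∑ e, w e * (f (insert e S) - f S) with hG'
  have hd : ∀ s, HasDerivAt (fun s => Real.exp (s / 2) * G s)
      (Real.exp (s / 2) * (1 / 2) * G s + Real.exp (s / 2) * G' s) s := by
    intro s
    exact (((hasDerivAt_id s).div_const 2).exp).mul (hasDerivAt_sum_bernoulliWeight w f s)
  have hle : ∀ s, 0 ≤ s → G' s ≤ -(1 / 2) * G s := by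
    intro s hs
    rw [hG, hG', Finset.mul_sum]
    refine Finset.sum_le_sum fun S _ => ?_
    have hb : 0 ≤ bernoulliWeight (fun e => Real.exp (-s * w e)) S :=
      bernoulliWeight_nonneg (fun e => (Real.exp_pos _).le)
        (fun e => Real.exp_le_one_iff.2 (by nlinarith [hw e, mul_nonneg hs (hw e)])) S
    have h1 : ∑ e, w e * (f (insert e S) - f S) = -∑ e, w e * (f S - f (insert e S)) := by
      rw [← Finset.sum_neg_distrib]
      exact Finset.sum_congr rfl fun e _ => by ring
    rw [h1]
    nlinarith [hf S, mul_le_mul_of_nonneg_left (hf S) hb]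
  have hanti : AntitoneOn (fun s => Real.exp (s / 2) * G s) (Set.Ici 0) := by
    refine antitoneOn_of_deriv_nonpos (convex_Ici 0)
      (fun x _ => (hd x).continuousAt.continuousWithinAt)
      (fun x _ => (hd x).differentiableAt.differentiableWithinAt) fun x hx => ?_
    rw [interior_Ici] at hx
    rw [(hd x).deriv]
    nlinarith [mul_le_mul_of_nonneg_left (hle x (le_of_lt hx)) (Real.exp_pos (x / 2)).le]
  have h0 := hanti (Set.mem_Ici.2 le_rfl) (Set.mem_Ici.2 hs) hs
  have hG0 : G 0 = f ∅ := by
    rw [hG]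
    simp only
    rw [Finset.sum_eq_single ∅]
    · simp [bernoulliWeight]
    · intro S _ hS
      obtain ⟨e, he⟩ := Finset.nonempty_iff_ne_empty.2 hS
      have : bernoulliWeight (fun e => Real.exp (-0 * w e)) S = 0 :=
        Finset.prod_eq_zero (Finset.mem_univ e) (by simp [he])
      rw [this, zero_mul]
    · simp
  simp only [zero_div, Real.exp_zero, one_mul, hG0] at h0
  calc G s = Real.exp (-s / 2) * (Real.exp (s / 2) * G s) := by
        rw [← mul_assoc, ← Real.exp_add]; simp [neg_div]
    _ ≤ Real.exp (-s / 2) * f ∅ := mul_le_mul_of_nonneg_left h0 (Real.exp_pos _).le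
    _ = _ := mul_comm _ _

end Sampling

/-! ### Sampling a spanning set of a matroid -/

section MatroidSampling

variable {E : Type*} [Fintype E] {M : Matroid E}

lemma coe_rankOf (M : Matroid E) (X : Set E) : (rankOf M X : ℕ∞) = M.eRk X :=
  ENat.natCast_toNat ((M.eRk_le_encard X).trans_lt (Set.encard_lt_top_iff.2 X.toFinite)).ne

lemma coe_rankM (M : Matroid E) : (rankM M : ℕ∞) = M.eRank :=
  ENat.natCast_toNat (M.eRank_le_encard_ground.trans_lt
    (Set.encard_lt_top_iff.2 (Set.toFinite _))).ne

lemma rankOf_le_rankM (M : Matroid E) (X : Set E) : rankOf M X ≤ rankM M := by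
  have h := M.eRk_le_eRank X
  rw [← coe_rankOf, ← coe_rankM] at h
  exact_mod_cast h

lemma rankOf_mono (M : Matroid E) {X Y : Set E} (h : X ⊆ Y) : rankOf M X ≤ rankOf M Y := by
  have h := M.eRk_mono h
  rw [← coe_rankOf, ← coe_rankOf] at h
  exact_mod_cast h

lemma spanning_iff_rankOf (hE : M.E = Set.univ) {X : Set E} :
    M.Spanning X ↔ rankM M ≤ rankOf M X := by
  have : M.Finite := ⟨Set.toFinite _⟩
  rw [Matroid.spanning_iff_eRk_le (by simp [hE]), ← coe_rankOf, ← coe_rankM]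
  norm_cast

omit [Fintype E] in
lemma rankOf_closure (M : Matroid E) (X : Set E) : rankOf M (M.closure X) = rankOf M X := by
  rw [rankOf, rankOf, M.eRk_closure_eq]

lemma rankOf_insert (hE : M.E = Set.univ) {X : Set E} {e : E} (he : e ∉ M.closure X) :
    rankOf M (insert e X) = rankOf M X + 1 := by
  have h := Matroid.eRk_insert_eq_add_one (M := M) (X := X) (e := e) ⟨by simp [hE], he⟩
  rw [← coe_rankOf, ← coe_rankOf] at h
  exact_mod_cast h

open scoped Classical in
/-- A vector below the rank function whose total mass is within `1/2` of the rank puts, outside of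
every flat, a mass of at least half the missing rank; hence the rank deficiency of a random set
that includes `e` with probability `1 - exp (-s * w e)` decays like `exp (-s / 2)`. -/
lemma sum_bernoulliWeight_not_spanning_le (hE : M.E = Set.univ) {w : E → ℝ} (hw : ∀ e, 0 ≤ w e)
    (hrk : ∀ S : Finset E, ∑ e ∈ S, w e ≤ (rankOf M (S : Set E) : ℝ))
    (htot : (rankM M : ℝ) - 1 / 2 ≤ ∑ e, w e) {s : ℝ} (hs : 0 ≤ s) :
    ∑ S ∈ Finset.univ.filter (fun S : Finset E => ¬ M.Spanning (S : Set E)),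
      bernoulliWeight (fun e => Real.exp (-s * w e)) S ≤ rankM M * Real.exp (-s / 2) := by
  set f : Finset E → ℝ := fun S => rankM M - rankOf M (S : Set E) with hf
  have hle : ∀ S : Finset E, (rankOf M (S : Set E) : ℝ) ≤ rankM M := fun S => by
    exact_mod_cast rankOf_le_rankM M _
  have hdecay : ∀ S, f S / 2 ≤ ∑ e, w e * (f S - f (insert e S)) := by
    intro S
    have hterm : ∀ e, (if e ∈ M.closure (S : Set E) then 0 else w e) ≤
        w e * (f S - f (insert e S)) := by
      intro e
      split_ifs with he
      · refine mul_nonneg (hw e) ?_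
        have : (rankOf M (S : Set E) : ℝ) ≤ rankOf M ((insert e S : Finset E) : Set E) := by
          exact_mod_cast rankOf_mono M (by simp)
        simp only [hf]; linarith
      · have : rankOf M ((insert e S : Finset E) : Set E) = rankOf M (S : Set E) + 1 := by
          rw [Finset.coe_insert]; exact rankOf_insert hE he
        simp only [hf, this]; push_cast; linarith
    refine le_trans ?_ (Finset.sum_le_sum fun e _ => hterm e)
    have hsplit : ∑ e, (if e ∈ M.closure (S : Set E) then 0 else w e) =
        ∑ e, w e - ∑ e with e ∈ M.closure (S : Set E), w e := by
      rw [Finset.sum_filter, ← Finset.sum_sub_distrib]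
      exact Finset.sum_congr rfl fun e _ => by split_ifs <;> simp
    have hcl := hrk (Finset.univ.filter fun e => e ∈ M.closure (S : Set E))
    have hcoe : ((Finset.univ.filter fun e => e ∈ M.closure (S : Set E) : Finset E) : Set E) =
      M.closure (S : Set E) := by ext; simp
    rw [hcoe, rankOf_closure] at hcl
    rcases (rankOf_le_rankM M (S : Set E)).eq_or_lt with h | h
    · have : f S = 0 := by simp [hf, h]
      rw [this, zero_div]
      exact Finset.sum_nonneg fun e _ => by split_ifs <;> simp [hw e]
    · have : (rankOf M (S : Set E) : ℝ) + 1 ≤ rankM M := by exact_mod_cast h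
      rw [hsplit]; simp only [hf]; linarith
  have hq0 : ∀ e, 0 ≤ Real.exp (-s * w e) := fun e => (Real.exp_pos _).le
  have hq1 : ∀ e, Real.exp (-s * w e) ≤ 1 := fun e =>
    Real.exp_le_one_iff.2 (by nlinarith [mul_nonneg hs (hw e)])
  calc _ ≤ ∑ S ∈ Finset.univ.filter (fun S : Finset E => ¬ M.Spanning (S : Set E)),
          bernoulliWeight (fun e => Real.exp (-s * w e)) S * f S := by
        refine Finset.sum_le_sum fun S hS => ?_
        have h := (Finset.mem_filter.1 hS).2
        rw [spanning_iff_rankOf hE, not_le] at h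
        have : (rankOf M (S : Set E) : ℝ) + 1 ≤ rankM M := by exact_mod_cast h
        have hb := bernoulliWeight_nonneg hq0 hq1 S
        have h1 : 1 ≤ f S := by simp only [hf]; linarith
        nlinarith
    _ ≤ ∑ S : Finset E, bernoulliWeight (fun e => Real.exp (-s * w e)) S * f S := by
        refine Finset.sum_le_sum_of_subset_of_nonneg (Finset.filter_subset _ _) fun S _ _ => ?_
        exact mul_nonneg (bernoulliWeight_nonneg hq0 hq1 S) (sub_nonneg.2 (hle S))
    _ ≤ f ∅ * Real.exp (-s / 2) := sum_bernoulliWeight_le_exp hw hdecay hs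
    _ ≤ _ := by
        refine mul_le_mul_of_nonneg_right ?_ (Real.exp_pos _).le
        simp [hf]

end MatroidSampling

/-! ### The seed: independence and the law of fresh thresholds -/

section Seed

variable {E : Type*}

instance : IsProbabilityMeasure (seedLaw E) := by unfold seedLaw; infer_instance

/-- Events that depend on disjoint sets of coordinates of the seed are independent. -/
lemma seedLaw_inter_of_dependsOn (I : Set (ℕ × ℕ × E)) {A B : Set (Seed E)}
    (hA : MeasurableSet A) (hB : MeasurableSet B)
    (hAI : ∀ ω ω' : Seed E, (∀ i ∈ I, ω i = ω' i) → ω ∈ A → ω' ∈ A)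
    (hBI : ∀ ω ω' : Seed E, (∀ i ∈ Iᶜ, ω i = ω' i) → ω ∈ B → ω' ∈ B) :
    seedLaw E (A ∩ B) = seedLaw E A * seedLaw E B := by
  classical
  have hindep : ProbabilityTheory.iIndep
      (fun i : ℕ × ℕ × E => MeasurableSpace.comap (fun ω : Seed E => ω i) inferInstance)
      (seedLaw E) :=
    (ProbabilityTheory.iIndepFun_infinitePi
      (P := fun _ : ℕ × ℕ × E => (volume : Measure unitInterval))
      (X := fun _ x => x) fun _ => measurable_id)
  have hdisj := ProbabilityTheory.indep_iSup_of_disjoint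
    (fun i => (measurable_pi_apply i).comap_le) hindep (disjoint_compl_right (a := I))
  -- An event that depends on the coordinates in `J` is the preimage of itself under the map that
  -- resets all other coordinates, and this map is measurable for the coordinates in `J`.
  have key : ∀ (J : Set (ℕ × ℕ × E)) (D : Set (Seed E)), MeasurableSet D →
      (∀ ω ω' : Seed E, (∀ i ∈ J, ω i = ω' i) → ω ∈ D → ω' ∈ D) →
      MeasurableSet[⨆ i ∈ J, MeasurableSpace.comap (fun ω : Seed E => ω i) inferInstance] D := by
    intro J D hD hDJ
    set g : Seed E → Seed E := fun ω i => if i ∈ J then ω i else 0 with hg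
    have hDg : D = g ⁻¹' D := by
      ext ω
      exact ⟨fun h => hDJ ω (g ω) (fun i hi => by simp [hg, hi]) h,
        fun h => hDJ (g ω) ω (fun i hi => by simp [hg, hi]) h⟩
    have hgm : Measurable[⨆ i ∈ J, MeasurableSpace.comap (fun ω : Seed E => ω i) inferInstance,
        MeasurableSpace.pi] g := by
      refine @measurable_pi_lambda _ _ _ (_) _ _ fun i => ?_
      by_cases hi : i ∈ J
      · simp only [hg, hi, if_true]
        exact (comap_measurable fun ω : Seed E => ω i).mono
          (le_iSup₂_of_le i hi le_rfl) le_rfl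
      · simp only [hg, hi, if_false]
        exact @measurable_const _ _ _ (_) _
    rw [hDg]
    exact hgm hD
  exact (ProbabilityTheory.Indep_iff _ _ _).1 hdisj A B (key I A hA hAI) (key Iᶜ B hB hBI)

lemma measurable_freshThresholds (L : ℝ) (t k : ℕ) :
    Measurable fun ω : Seed E => freshThresholds L ω t k := by
  unfold freshThresholds
  fun_prop

lemma seedLaw_eval_preimage (i : ℕ × ℕ × E) {s : Set unitInterval} (hs : MeasurableSet s) :
    seedLaw E {ω | ω i ∈ s} = volume s := by
  rw [seedLaw]
  exact (measurePreserving_eval_infinitePi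
    (fun _ => (volume : Measure unitInterval)) i).measure_preimage hs.nullMeasurableSet

lemma volume_unitInterval_Iic_le (b : ℝ) :
    (volume : Measure unitInterval) {u | (u : ℝ) ≤ b} ≤ ENNReal.ofReal b := by
  rw [unitInterval.volume_apply]
  calc _ ≤ volume (Set.Icc 0 b) := measure_mono (by rintro _ ⟨u, hu, rfl⟩; exact ⟨u.2.1, hu⟩)
    _ = _ := by simp

lemma volume_unitInterval_Ioc_le (a b : ℝ) :
    (volume : Measure unitInterval) {u | a < (u : ℝ) ∧ (u : ℝ) ≤ b} ≤ ENNReal.ofReal (b - a) := by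
  rw [unitInterval.volume_apply]
  calc _ ≤ volume (Set.Ioc a b) := measure_mono (by rintro _ ⟨u, hu, rfl⟩; exact hu)
    _ = _ := by simp

lemma seedLaw_mem_roundAt_le {L : ℝ} (hL : 0 < L) (x : E → ℝ) (t k : ℕ) (e : E) :
    seedLaw E {ω | e ∈ roundAt x (freshThresholds L ω t k)} ≤ ENNReal.ofReal (L * x e) := by
  have h : {ω : Seed E | e ∈ roundAt x (freshThresholds L ω t k)} =
      {ω | ω (t, k, e) ∈ {u : unitInterval | (u : ℝ) ≤ L * x e}} := by
    ext ω
    simp [roundAt, freshThresholds, div_le_iff₀ hL, mul_comm]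
  rw [h, seedLaw_eval_preimage _ (measurableSet_le (by fun_prop) (by fun_prop))]
  exact volume_unitInterval_Iic_le _

lemma seedLaw_mem_roundAt_diff_le {L : ℝ} (hL : 0 < L) (x x' : E → ℝ) (t k : ℕ) (e : E) :
    seedLaw E {ω | e ∈ roundAt x (freshThresholds L ω t k) \ roundAt x' (freshThresholds L ω t k)}
      ≤ ENNReal.ofReal (L * (x e - x' e)) := by
  have h : {ω : Seed E | e ∈ roundAt x (freshThresholds L ω t k) \
        roundAt x' (freshThresholds L ω t k)} =
      {ω | ω (t, k, e) ∈ {u : unitInterval | L * x' e < (u : ℝ) ∧ (u : ℝ) ≤ L * x e}} := by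
    ext ω
    simp [roundAt, freshThresholds, div_le_iff₀ hL, mul_comm, and_comm]
  have hm : MeasurableSet {u : unitInterval | L * x' e < (u : ℝ) ∧ (u : ℝ) ≤ L * x e} :=
    measurable_subtype_coe (measurableSet_Ioc (a := L * x' e) (b := L * x e))
  rw [h, seedLaw_eval_preimage _ hm]
  exact (volume_unitInterval_Ioc_le _ _).trans_eq (by ring_nf)

variable [Fintype E]

omit [Fintype E] in
lemma measurable_roundAt (x : E → ℝ) : Measurable fun τ : E → ℝ => roundAt x τ := by
  refine measurable_set_iff.2 fun e => ?_
  exact measurableSet_setOfPred.1 (measurableSet_le (measurable_pi_apply e) measurable_const)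

lemma measurableSet_roundAt_mem (x : E → ℝ) (P : Set E → Prop) :
    MeasurableSet {τ : E → ℝ | P (roundAt x τ)} :=
  (measurable_roundAt x) (Set.toFinite {X | P X}).measurableSet

lemma measurableSet_fresh_roundAt (L : ℝ) (t k : ℕ) (x : E → ℝ) (P : Set E → Prop) :
    MeasurableSet {ω : Seed E | P (roundAt x (freshThresholds L ω t k))} :=
  (measurable_freshThresholds L t k) (measurableSet_roundAt_mem x P)

open scoped Classical in
/-- Fresh thresholds at the vector `(1 - q) / L` select each element `e` independently with
probability `1 - q e`. -/
lemma seedLaw_roundAt_eq {L : ℝ} (hL : 0 < L) {q : E → ℝ} (h0 : ∀ e, 0 ≤ q e)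
    (h1 : ∀ e, q e ≤ 1) (t k : ℕ) (S : Finset E) :
    seedLaw E {ω | roundAt (fun e => (1 - q e) / L) (freshThresholds L ω t k) = (S : Set E)} =
      ENNReal.ofReal (bernoulliWeight q S) := by
  set U : ℕ × ℕ × E → Set unitInterval := fun i =>
    if i.2.2 ∈ S then Set.Iic ⟨1 - q i.2.2, by linarith [h1 i.2.2], by linarith [h0 i.2.2]⟩
    else Set.Ioi ⟨1 - q i.2.2, by linarith [h1 i.2.2], by linarith [h0 i.2.2]⟩ with hU
  have hinj : Function.Injective fun e : E => (t, k, e) := fun e e' h => by simpa using h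
  have hset : {ω : Seed E |
        roundAt (fun e => (1 - q e) / L) (freshThresholds L ω t k) = (S : Set E)} =
      Set.pi ((Finset.univ.map ⟨fun e : E => (t, k, e), hinj⟩ : Finset _) :
        Set (ℕ × ℕ × E)) U := by
    ext ω
    simp only [Set.mem_ofPred_eq, Set.ext_iff, Set.mem_pi, Finset.coe_map, Set.mem_image,
      Function.Embedding.coeFn_mk, Finset.coe_univ, Set.mem_univ, true_and, forall_exists_index,
      forall_apply_eq_imp_iff]
    refine forall_congr' fun e => ?_
    have he : e ∈ roundAt (fun e => (1 - q e) / L) (freshThresholds L ω t k) ↔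
        (ω (t, k, e) : ℝ) ≤ 1 - q e := by
      simp [roundAt, freshThresholds, div_le_div_iff_of_pos_right hL]
    rw [he]
    by_cases h : e ∈ S
    · simp [hU, h, ← Subtype.coe_le_coe]
    · simp [hU, h, ← Subtype.coe_lt_coe]
  rw [hset, seedLaw, Measure.infinitePi_pi, Finset.prod_map, bernoulliWeight,
    ENNReal.ofReal_prod_of_nonneg]
  · refine Finset.prod_congr rfl fun e _ => ?_
    by_cases h : e ∈ S
    · simp [hU, h, unitInterval.volume_Iic]
    · simp [hU, h, unitInterval.volume_Ioi]
  · intro e _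
    split_ifs
    · linarith [h1 e]
    · exact h0 e
  · intro i _
    simp only [hU]
    split_ifs
    · exact measurableSet_Iic
    · exact measurableSet_Ioi

/-- Fresh thresholds at a vector `w` as in `sum_bernoulliWeight_not_spanning_le` give a spanning set
with high probability. -/
lemma seedLaw_not_spanning_le {M : Matroid E} (hE : M.E = Set.univ) {L : ℝ} (hL : 0 < L)
    {w : E → ℝ} (hw : ∀ e, 0 ≤ w e)
    (hrk : ∀ S : Finset E, ∑ e ∈ S, w e ≤ (rankOf M (S : Set E) : ℝ))
    (htot : (rankM M : ℝ) - 1 / 2 ≤ ∑ e, w e) (t k : ℕ) :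
    seedLaw E {ω | ¬ M.Spanning (roundAt w (freshThresholds L ω t k))} ≤
      ENNReal.ofReal (rankM M * Real.exp (-L / 2)) := by
  classical
  set q : E → ℝ := fun e => Real.exp (-L * w e) with hq
  have h0 : ∀ e, 0 ≤ q e := fun e => (Real.exp_pos _).le
  have h1 : ∀ e, q e ≤ 1 := fun e =>
    Real.exp_le_one_iff.2 (by nlinarith [mul_nonneg hL.le (hw e)])
  -- Lowering `w` to `(1 - q) / L` gives selection probabilities of the form treated above.
  have hqw : ∀ e, (1 - q e) / L ≤ w e := by
    intro e
    rw [div_le_iff₀ hL]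
    have := Real.add_one_le_exp (-L * w e)
    simp only [hq]
    linarith
  calc _ ≤ seedLaw E (⋃ S ∈ Finset.univ.filter (fun S : Finset E => ¬ M.Spanning (S : Set E)),
        {ω | roundAt (fun e => (1 - q e) / L) (freshThresholds L ω t k) = (S : Set E)}) := by
        refine measure_mono fun ω hω => ?_
        simp only [Set.mem_iUnion]
        refine ⟨(roundAt (fun e => (1 - q e) / L) (freshThresholds L ω t k)).toFinset, ?_, by simp⟩
        simp only [Finset.mem_filter, Finset.mem_univ, true_and, Set.coe_toFinset]
        intro hsp
        refine hω (hsp.superset (fun e he => ?_) (by simp [hE]))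
        exact le_trans he (hqw e)
    _ ≤ ∑ S ∈ Finset.univ.filter (fun S : Finset E => ¬ M.Spanning (S : Set E)),
        ENNReal.ofReal (bernoulliWeight q S) := by
        refine (measure_biUnion_finset_le _ _).trans (Finset.sum_le_sum fun S _ => ?_)
        exact (seedLaw_roundAt_eq hL h0 h1 t k S).le
    _ = ENNReal.ofReal (∑ S ∈ Finset.univ.filter (fun S : Finset E => ¬ M.Spanning (S : Set E)),
        bernoulliWeight q S) :=
        (ENNReal.ofReal_sum_of_nonneg fun S _ => bernoulliWeight_nonneg h0 h1 S).symm
    _ ≤ _ := ENNReal.ofReal_le_ofReal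
        (sum_bernoulliWeight_not_spanning_le hE hw hrk htot hL.le)

end Seed

/-! ### Parameters of the instance -/

section Parameters

variable {E : Type*} [Fintype E] {M : Matroid E} {a : E → ℝ}

lemma nonempty_of_one_le_rankM (hr : 1 ≤ rankM M) : Nonempty E := by
  by_contra h
  rw [not_nonempty_iff] at h
  have h1 := M.eRank_le_encard_ground
  rw [← coe_rankM, Set.eq_empty_of_isEmpty M.E, Set.encard_empty] at h1
  have : rankM M ≤ 0 := by exact_mod_cast h1
  omega

lemma aMin_le (a : E → ℝ) (e : E) : aMin a ≤ a e := ciInf_le (Set.finite_range a).bddBelow e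

lemma le_aMax (a : E → ℝ) (e : E) : a e ≤ aMax a := le_ciSup (Set.finite_range a).bddAbove e

lemma aMin_pos [Nonempty E] (ha : ∀ e, 0 < a e) : 0 < aMin a := by
  obtain ⟨e, he⟩ := exists_eq_ciInf_of_finite (f := a)
  exact (ha e).trans_eq he

lemma aMin_le_aMax [Nonempty E] (a : E → ℝ) : aMin a ≤ aMax a :=
  (aMin_le a (Classical.arbitrary E)).trans (le_aMax a _)

omit [Fintype E] in
lemma bigR_eq (M : Matroid E) (a : E → ℝ) : bigR M a = 8 * rho M a := by
  rw [bigR, rho]; ring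

lemma rankM_le_rho (hr : 1 ≤ rankM M) (ha : ∀ e, 0 < a e) : (rankM M : ℝ) ≤ rho M a := by
  have := nonempty_of_one_le_rankM hr
  rw [rho, le_div_iff₀ (aMin_pos ha)]
  exact mul_le_mul_of_nonneg_left (aMin_le_aMax a) (Nat.cast_nonneg _)

lemma eight_le_bigR (hr : 1 ≤ rankM M) (ha : ∀ e, 0 < a e) : 8 ≤ bigR M a := by
  have h := rankM_le_rho (M := M) hr ha
  have : (1 : ℝ) ≤ rankM M := by exact_mod_cast hr
  rw [bigR_eq]; linarith

lemma log_bigR_pos (hr : 1 ≤ rankM M) (ha : ∀ e, 0 < a e) : 0 < Real.log (bigR M a) :=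
  Real.log_pos (by linarith [eight_le_bigR (M := M) hr ha])

lemma bigL_pos (hr : 1 ≤ rankM M) (ha : ∀ e, 0 < a e) : 0 < bigL M a :=
  mul_pos (by norm_num) (log_bigR_pos hr ha)

lemma exp_neg_bigL_div_two (hr : 1 ≤ rankM M) (ha : ∀ e, 0 < a e) :
    Real.exp (-bigL M a / 2) = (bigR M a ^ 32)⁻¹ := by
  have hR := eight_le_bigR (M := M) hr ha
  have : -bigL M a / 2 = -((32 : ℕ) * Real.log (bigR M a)) := by rw [bigL]; push_cast; ring
  rw [this, Real.exp_neg, Real.exp_nat_mul, Real.exp_log (by linarith)]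

lemma aMin_mul_bigR (hr : 1 ≤ rankM M) (ha : ∀ e, 0 < a e) :
    aMin a * bigR M a = 8 * (rankM M * aMax a) := by
  have := nonempty_of_one_le_rankM hr
  have := aMin_pos ha
  rw [bigR]
  field_simp

end Parameters

/-! ### Fractional solutions that move little -/

section Movement

variable {E : Type*} [Fintype E] {M : Matroid E} {T : ℕ} {y z : ℕ → E → ℝ}

omit [Fintype E] in
lemma sub_sum_decrease_le (z : ℕ → E → ℝ) (e : E) {m t : ℕ} (h : m ≤ t) :
    z m e - ∑ s ∈ Finset.Ioc m t, max (z (s - 1) e - z s e) 0 ≤ z t e := by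
  induction t, h using Nat.le_induction with
  | base => simp
  | succ t hmt ih =>
    rw [← Finset.insert_Ioc_right_eq_Ioc_add_one hmt, Finset.sum_insert (by simp)]
    have := le_max_left (z (t + 1 - 1) e - z (t + 1) e) 0
    rw [Nat.add_sub_cancel] at this ⊢
    linarith

/-- The total decrease in one step equals the total increase, since all points of the base polytope
have the same coordinate sum. -/
lemma sum_decrease_le (h : IsFractional M T y z) {s : ℕ} (hs : 2 ≤ s) (hsT : s ≤ T) :
    ∑ e, max (z (s - 1) e - z s e) 0 ≤ ∑ e, y s e := by
  have h1 := (h.z_mem s (Finset.mem_Icc.2 ⟨by omega, hsT⟩)).2.2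
  have h2 := (h.z_mem (s - 1) (Finset.mem_Icc.2 ⟨by omega, by omega⟩)).2.2
  have h3 : ∑ e, (max (z (s - 1) e - z s e) 0 - (z (s - 1) e - z s e)) ≤ ∑ e, y s e := by
    refine Finset.sum_le_sum fun e _ => ?_
    have h4 := h.y_ge s (Finset.mem_Icc.2 ⟨by omega, hsT⟩) e
    have h5 := h.y_nonneg s (Finset.mem_Icc.2 ⟨by omega, hsT⟩) e
    rcases max_cases (z (s - 1) e - z s e) 0 with h | h <;> linarith
  rw [Finset.sum_sub_distrib, Finset.sum_sub_distrib, h1, h2] at h3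
  linarith

/-- If a fractional solution moves by at most `1/2` between times `m` and `l`, then all its vectors
in this period lie above one vector that is within `1/2` of the base polytope. -/
lemma exists_common_lower_bound (h : IsFractional M T y z) {m l : ℕ} (hm : 1 ≤ m) (hml : m ≤ l)
    (hl : l ≤ T) (hy : ∑ s ∈ Finset.Ioc m l, ∑ e, y s e ≤ 1 / 2) :
    ∃ w : E → ℝ, (∀ e, 0 ≤ w e) ∧ (∀ t, m ≤ t → t ≤ l → ∀ e, w e ≤ z t e) ∧
      (∀ S : Finset E, ∑ e ∈ S, w e ≤ (rankOf M (S : Set E) : ℝ)) ∧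
      (rankM M : ℝ) - 1 / 2 ≤ ∑ e, w e := by
  have hz : ∀ t, m ≤ t → t ≤ l → z t ∈ basePolytope M := fun t h1 h2 =>
    h.z_mem t (Finset.mem_Icc.2 ⟨by omega, by omega⟩)
  set v : E → ℝ := fun e => z m e - ∑ s ∈ Finset.Ioc m l, max (z (s - 1) e - z s e) 0 with hv
  have hwz : ∀ t, m ≤ t → t ≤ l → ∀ e, max (v e) 0 ≤ z t e := by
    intro t h1 h2 e
    refine max_le (le_trans ?_ (sub_sum_decrease_le z e h1)) ((hz t h1 h2).1 e)
    simp only [hv]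
    have : ∑ s ∈ Finset.Ioc m t, max (z (s - 1) e - z s e) 0 ≤
        ∑ s ∈ Finset.Ioc m l, max (z (s - 1) e - z s e) 0 :=
      Finset.sum_le_sum_of_subset_of_nonneg (Finset.Ioc_subset_Ioc_right h2)
        fun _ _ _ => le_max_right _ _
    linarith
  refine ⟨fun e => max (v e) 0, fun e => le_max_right _ _, hwz, fun S => ?_, ?_⟩
  · exact (Finset.sum_le_sum fun e _ => hwz m le_rfl hml e).trans ((hz m le_rfl hml).2.1 S)
  · calc (rankM M : ℝ) - 1 / 2 ≤ rankM M - ∑ s ∈ Finset.Ioc m l, ∑ e, y s e := by linarith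
      _ ≤ rankM M - ∑ s ∈ Finset.Ioc m l, ∑ e, max (z (s - 1) e - z s e) 0 := by
          refine sub_le_sub_left (Finset.sum_le_sum fun s hs => ?_) _
          have := Finset.mem_Ioc.1 hs
          exact sum_decrease_le h (by omega) (by omega)
      _ = ∑ e, v e := by
          rw [Finset.sum_sub_distrib, (hz m le_rfl hml).2.2, Finset.sum_comm]
      _ ≤ _ := Finset.sum_le_sum fun e _ => le_max_left _ _

end Movement

/-! ### Epochs -/

section Epochs

variable {E : Type*} [Fintype E] {M : Matroid E} {a : E → ℝ} {T : ℕ} {y z : ℕ → E → ℝ}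

open scoped Classical in
/-- The first timestep of the epoch that contains time `t ≥ 1`. -/
def lastStart (M : Matroid E) (a : E → ℝ) (y : ℕ → E → ℝ) : ℕ → ℕ
  | 0 => 0
  | t + 1 => if EpochStart M a y (t + 1) then t + 1 else lastStart M a y t

lemma lastStart_eq_self {t : ℕ} (h : EpochStart M a y t) : lastStart M a y t = t := by
  cases t with
  | zero => rfl
  | succ t => rw [lastStart, if_pos h]

lemma lastStart_succ {t : ℕ} (h : ¬ EpochStart M a y (t + 1)) :
    lastStart M a y (t + 1) = lastStart M a y t := by
  rw [lastStart, if_neg h]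

lemma lastStart_le (M : Matroid E) (a : E → ℝ) (y : ℕ → E → ℝ) (t : ℕ) : lastStart M a y t ≤ t := by
  induction t with
  | zero => rfl
  | succ t ih =>
    by_cases h : EpochStart M a y (t + 1)
    · exact (lastStart_eq_self h).le
    · rw [lastStart_succ h]; omega

lemma epochStart_lastStart {t : ℕ} (ht : 1 ≤ t) : EpochStart M a y (lastStart M a y t) := by
  induction t, ht using Nat.le_induction with
  | base => rw [lastStart_eq_self (Or.inl rfl)]; exact Or.inl rfl
  | succ t _ ih =>
    by_cases h : EpochStart M a y (t + 1)
    · rwa [lastStart_eq_self h]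
    · rwa [lastStart_succ h]

lemma one_le_lastStart {t : ℕ} (ht : 1 ≤ t) : 1 ≤ lastStart M a y t := by
  induction t, ht using Nat.le_induction with
  | base => rw [lastStart_eq_self (Or.inl rfl)]
  | succ t _ ih =>
    by_cases h : EpochStart M a y (t + 1)
    · rw [lastStart_eq_self h]; omega
    · rwa [lastStart_succ h]

lemma lastStart_eq_of_le {s t : ℕ} (h1 : lastStart M a y t ≤ s) (h2 : s ≤ t) :
    lastStart M a y s = lastStart M a y t := by
  induction t, h2 using Nat.le_induction with
  | base => rfl
  | succ t hst ih =>
    by_cases h : EpochStart M a y (t + 1)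
    · rw [lastStart_eq_self h] at h1; omega
    · rw [lastStart_succ h] at h1 ⊢; exact ih h1

lemma not_epochStart_of_lastStart_lt {s t : ℕ} (h1 : lastStart M a y t < s) (h2 : s ≤ t) :
    ¬ EpochStart M a y s := fun h => by
  have := lastStart_eq_of_le h1.le h2
  rw [lastStart_eq_self h] at this
  omega

/-- The fractional acquisition cost at time `t`. -/
def acquisition (a : E → ℝ) (y : ℕ → E → ℝ) (t : ℕ) : ℝ := ∑ e, a e * y t e

lemma acquisition_nonneg (ha : ∀ e, 0 < a e) (h : IsFractional M T y z) {t : ℕ} (ht : 1 ≤ t)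
    (htT : t ≤ T) : 0 ≤ acquisition a y t :=
  Finset.sum_nonneg fun e _ => mul_nonneg (ha e).le (h.y_nonneg t (Finset.mem_Icc.2 ⟨ht, htT⟩) e)

lemma epochCost_succ_of_not_epochStart {t : ℕ} (h : ¬ EpochStart M a y (t + 1)) :
    epochCost M a y (t + 1) = epochCost M a y t + acquisition a y (t + 1) := by
  rw [EpochStart, not_or, Nat.add_sub_cancel] at h
  rw [epochCost, if_neg h.2, acquisition]

lemma epochCost_nonneg (ha : ∀ e, 0 < a e) (h : IsFractional M T y z) {t : ℕ} (htT : t ≤ T) :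
    0 ≤ epochCost M a y t := by
  induction t with
  | zero => exact le_rfl
  | succ t ih =>
    have h1 := acquisition_nonneg ha h (t := t + 1) (by omega) htT
    rw [epochCost]
    refine add_nonneg ?_ h1
    split_ifs
    · exact le_rfl
    · exact ih (by omega)

lemma sum_acquisition_eq_sub {m l : ℕ} (hml : m ≤ l) (h : lastStart M a y l ≤ m) :
    ∑ s ∈ Finset.Ioc m l, acquisition a y s = epochCost M a y l - epochCost M a y m := by
  induction l, hml using Nat.le_induction with
  | base => simp
  | succ l hml ih =>
    have hns : ¬ EpochStart M a y (l + 1) := not_epochStart_of_lastStart_lt (by omega) le_rfl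
    rw [lastStart_succ hns] at h
    rw [← Finset.insert_Ioc_right_eq_Ioc_add_one hml, Finset.sum_insert (by simp), ih h,
      epochCost_succ_of_not_epochStart hns]
    ring

open scoped Classical in
/-- The timesteps up to `T` of the epoch that starts at time `p`. -/
def epochBlock (M : Matroid E) (a : E → ℝ) (y : ℕ → E → ℝ) (T p : ℕ) : Finset ℕ :=
  (Finset.Icc 1 T).filter fun t => lastStart M a y t = p

lemma mem_epochBlock {p t : ℕ} :
    t ∈ epochBlock M a y T p ↔ (1 ≤ t ∧ t ≤ T) ∧ lastStart M a y t = p := by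
  simp [epochBlock]

/-- The index of the group of a timestep when the timesteps of an epoch are grouped according to
the fractional acquisition cost paid in the epoch so far, in units of `a_min / 2`. The timestep
that completes an epoch may have an arbitrarily large cost; it forms the last group. -/
def costGroup (M : Matroid E) (a : E → ℝ) (y : ℕ → E → ℝ) (t : ℕ) : ℕ :=
  min ⌊2 * epochCost M a y t / aMin a⌋₊ ⌈bigR M a / 4⌉₊

lemma sum_y_le_half_of_costGroup_eq (hr : 1 ≤ rankM M) (ha : ∀ e, 0 < a e)
    (h : IsFractional M T y z) {p m l : ℕ} (hm : m ∈ epochBlock M a y T p)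
    (hl : l ∈ epochBlock M a y T p) (hml : m ≤ l)
    (hg : costGroup M a y m = costGroup M a y l) :
    ∑ s ∈ Finset.Ioc m l, ∑ e, y s e ≤ 1 / 2 := by
  have := nonempty_of_one_le_rankM hr
  have hamin := aMin_pos ha
  rw [mem_epochBlock] at hm hl
  rcases hml.eq_or_lt with rfl | hlt
  · simp
  have hpm : lastStart M a y l ≤ m := by
    have := lastStart_le M a y m
    omega
  have hcm : epochCost M a y m < rankM M * aMax a := by
    have := not_epochStart_of_lastStart_lt (M := M) (a := a) (y := y) (s := m + 1) (t := l)
      (by omega) (by omega)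
    rw [EpochStart, not_or, Nat.add_sub_cancel] at this
    exact not_le.1 this.2
  have hcm0 := epochCost_nonneg (M := M) ha h hm.1.2
  have hcl0 := epochCost_nonneg (M := M) ha h hl.1.2
  have hfl : ⌊2 * epochCost M a y m / aMin a⌋₊ < ⌈bigR M a / 4⌉₊ := by
    rw [Nat.floor_lt (by positivity)]
    refine lt_of_lt_of_le ?_ (Nat.le_ceil _)
    rw [div_lt_iff₀ hamin]
    nlinarith [aMin_mul_bigR (M := M) hr ha]
  rw [costGroup, costGroup, min_eq_left hfl.le] at hg
  have hfe : ⌊2 * epochCost M a y l / aMin a⌋₊ = ⌊2 * epochCost M a y m / aMin a⌋₊ := by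
    omega
  have h1 : 2 * epochCost M a y l / aMin a < ⌊2 * epochCost M a y m / aMin a⌋₊ + 1 := by
    rw [← hfe]; exact Nat.lt_floor_add_one _
  have h2 : (⌊2 * epochCost M a y m / aMin a⌋₊ : ℝ) ≤ 2 * epochCost M a y m / aMin a :=
    Nat.floor_le (by positivity)
  have h3 : 2 * epochCost M a y l < 2 * epochCost M a y m + aMin a := by
    have := h1.trans_le (add_le_add_left h2 1)
    rwa [div_add_one hamin.ne', div_lt_div_iff_of_pos_right hamin] at this
  have h4 : aMin a * ∑ s ∈ Finset.Ioc m l, ∑ e, y s e ≤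
      ∑ s ∈ Finset.Ioc m l, acquisition a y s := by
    rw [Finset.mul_sum]
    refine Finset.sum_le_sum fun s hs => ?_
    rw [Finset.mul_sum]
    refine Finset.sum_le_sum fun e _ => ?_
    have := Finset.mem_Ioc.1 hs
    exact mul_le_mul_of_nonneg_right (aMin_le a e)
      (h.y_nonneg s (Finset.mem_Icc.2 ⟨by omega, by omega⟩) e)
  rw [sum_acquisition_eq_sub hml hpm] at h4
  nlinarith

/-- One vector of fresh thresholds stays good for a whole epoch with probability at least
`1 - 1/R`: each of the at most `R` groups of timesteps has a common lower bound, which is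
rounded to a spanning set with high probability. -/
lemma seedLaw_exists_not_spanning_le (hE : M.E = Set.univ) (hr : 1 ≤ rankM M)
    (ha : ∀ e, 0 < a e) (h : IsFractional M T y z) (p s k : ℕ) :
    seedLaw E {ω | ∃ t ∈ epochBlock M a y T p,
      ¬ M.Spanning (roundAt (z t) (freshThresholds (bigL M a) ω s k))} ≤
      ENNReal.ofReal (bigR M a)⁻¹ := by
  classical
  set K := ⌈bigR M a / 4⌉₊ with hK
  have hR := eight_le_bigR (M := M) hr ha
  have hL := bigL_pos (M := M) hr ha
  have hgroup : ∀ i, seedLaw E {ω | ∃ t ∈ (epochBlock M a y T p).filter (costGroup M a y · = i),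
      ¬ M.Spanning (roundAt (z t) (freshThresholds (bigL M a) ω s k))} ≤
      ENNReal.ofReal (rankM M * Real.exp (-bigL M a / 2)) := by
    intro i
    set G := (epochBlock M a y T p).filter (costGroup M a y · = i) with hG
    rcases G.eq_empty_or_nonempty with h0 | hne
    · simp [h0]
    obtain ⟨hm, hmi⟩ := Finset.mem_filter.1 (G.min'_mem hne)
    obtain ⟨hl, hli⟩ := Finset.mem_filter.1 (G.max'_mem hne)
    have hml : G.min' hne ≤ G.max' hne := G.min'_le _ (G.max'_mem hne)
    obtain ⟨w, hw0, hwz, hwrk, hwtot⟩ := exists_common_lower_bound h (mem_epochBlock.1 hm).1.1 hml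
      (mem_epochBlock.1 hl).1.2
      (sum_y_le_half_of_costGroup_eq hr ha h hm hl hml (hmi.trans hli.symm))
    refine (measure_mono ?_).trans (seedLaw_not_spanning_le hE hL hw0 hwrk hwtot s k)
    rintro ω ⟨t, ht, hnsp⟩ hsp
    refine hnsp (hsp.superset (fun e he => ?_) (by simp [hE]))
    exact le_trans he (hwz t (G.min'_le _ ht) (G.le_max' _ ht) e)
  calc _ ≤ seedLaw E (⋃ i ∈ Finset.range (K + 1),
        {ω | ∃ t ∈ (epochBlock M a y T p).filter (costGroup M a y · = i),
          ¬ M.Spanning (roundAt (z t) (freshThresholds (bigL M a) ω s k))}) := by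
        refine measure_mono ?_
        rintro ω ⟨t, ht, hnsp⟩
        simp only [Set.mem_iUnion]
        exact ⟨costGroup M a y t, Finset.mem_range.2 (Nat.lt_succ_of_le (min_le_right _ _)), t,
          Finset.mem_filter.2 ⟨ht, rfl⟩, hnsp⟩
    _ ≤ ∑ i ∈ Finset.range (K + 1), ENNReal.ofReal (rankM M * Real.exp (-bigL M a / 2)) :=
        (measure_biUnion_finset_le _ _).trans (Finset.sum_le_sum fun i _ => hgroup i)
    _ = ENNReal.ofReal ((K + 1 : ℕ) * (rankM M * Real.exp (-bigL M a / 2))) := by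
        rw [Finset.sum_const, Finset.card_range, ← ENNReal.ofReal_nsmul, nsmul_eq_mul]
    _ ≤ _ := by
        refine ENNReal.ofReal_le_ofReal ?_
        have hK1 : ((K + 1 : ℕ) : ℝ) ≤ bigR M a := by
          have := Nat.ceil_lt_add_one (show 0 ≤ bigR M a / 4 by linarith)
          push_cast
          rw [← hK] at this
          linarith
        have hrR : (rankM M : ℝ) ≤ bigR M a := by
          have h1 := rankM_le_rho (M := M) hr ha
          have h2 := bigR_eq M a
          linarith
        rw [exp_neg_bigL_div_two hr ha, ← mul_assoc, ← div_eq_mul_inv,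
          div_le_iff₀ (by positivity)]
        calc ((K + 1 : ℕ) : ℝ) * rankM M ≤ bigR M a * bigR M a :=
              mul_le_mul hK1 hrR (Nat.cast_nonneg _) (by linarith)
          _ = bigR M a ^ 2 := by ring
          _ ≤ bigR M a ^ 31 := pow_le_pow_right₀ (by linarith) (by norm_num)
          _ = (bigR M a)⁻¹ * bigR M a ^ 32 := by
              rw [pow_succ (bigR M a) 31]; field_simp

end Epochs

/-! ### The thresholds: information used, measurability, structure -/

section Algorithm

variable {E : Type*} [Fintype E] {M : Matroid E} {a : E → ℝ} {T : ℕ} {y z : ℕ → E → ℝ}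

lemma epochCost_congr {y y' : ℕ → E → ℝ} {t : ℕ} (h : ∀ s ≤ t, y s = y' s) :
    epochCost M a y t = epochCost M a y' t := by
  induction t with
  | zero => rfl
  | succ t ih =>
    rw [epochCost, epochCost, ih fun s hs => h s (by omega), h (t + 1) le_rfl]

lemma epochStart_congr {y y' : ℕ → E → ℝ} {t : ℕ} (h : ∀ s ≤ t, y s = y' s) :
    EpochStart M a y t ↔ EpochStart M a y' t := by
  rw [EpochStart, EpochStart, epochCost_congr fun s hs => h s (by omega)]

omit [Fintype E] in
lemma freshThresholds_congr {L : ℝ} {ω ω' : Seed E} {t k : ℕ}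
    (h : ∀ e, ω (t, k, e) = ω' (t, k, e)) :
    freshThresholds L ω t k = freshThresholds L ω' t k := by
  funext e
  rw [freshThresholds, freshThresholds, h e]

lemma thresholds_congr {y z y' z' : ℕ → E → ℝ} {ω ω' : Seed E} {t : ℕ}
    (h : ∀ s ≤ t, y s = y' s ∧ z s = z' s)
    (hω : ∀ s ≤ t, ∀ k e, ω (s, k, e) = ω' (s, k, e)) :
    thresholds M a y z ω t = thresholds M a y' z' ω' t := by
  induction t with
  | zero => rfl
  | succ t ih =>
    have h1 := ih (fun s hs => h s (by omega)) fun s hs => hω s (by omega)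
    have h2 : ∀ k, freshThresholds (bigL M a) ω (t + 1) k =
        freshThresholds (bigL M a) ω' (t + 1) k :=
      fun k => freshThresholds_congr (hω (t + 1) le_rfl k)
    rw [thresholds, thresholds, h1, (h (t + 1) le_rfl).2,
      epochStart_congr fun s hs => (h s hs).1]
    simp only [h2]

/-- The thresholds are drawn afresh at time `t`. -/
def Redraw (M : Matroid E) (a : E → ℝ) (y z : ℕ → E → ℝ) (t : ℕ) (ω : Seed E) : Prop :=
  ¬ (¬ EpochStart M a y t ∧ M.Spanning (roundAt (z t) (thresholds M a y z ω (t - 1))))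

/-- The `k`-th fresh vector of thresholds drawn at time `s` rounds `z t` to a spanning set. -/
def FreshSpanning (M : Matroid E) (a : E → ℝ) (z : ℕ → E → ℝ) (s k t : ℕ) (ω : Seed E) : Prop :=
  M.Spanning (roundAt (z t) (freshThresholds (bigL M a) ω s k))

/-- The event that the `k`-th fresh vector of thresholds at time `t` is considered by the
algorithm: there is a redraw, and the fresh vectors before it are rejected. -/
def attempt (M : Matroid E) (a : E → ℝ) (y z : ℕ → E → ℝ) (t k : ℕ) : Set (Seed E) :=
  {ω | Redraw M a y z t ω ∧ ∀ j < k, ¬ FreshSpanning M a z t j t ω}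

/-- The index of the first fresh vector at time `t` that gives a spanning set (`0` if none does). -/
def firstSpanning (M : Matroid E) (a : E → ℝ) (z : ℕ → E → ℝ) (t : ℕ) (ω : Seed E) : ℕ :=
  sInf {k | FreshSpanning M a z t k t ω}

lemma thresholds_of_redraw {t : ℕ} {ω : Seed E} (h : Redraw M a y z (t + 1) ω) :
    thresholds M a y z ω (t + 1) =
      freshThresholds (bigL M a) ω (t + 1) (firstSpanning M a z (t + 1) ω) := by
  rw [Redraw, Nat.add_sub_cancel] at h
  rw [thresholds, if_neg h]
  rfl

lemma thresholds_of_not_redraw {t : ℕ} {ω : Seed E} (h : ¬ Redraw M a y z (t + 1) ω) :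
    thresholds M a y z ω (t + 1) = thresholds M a y z ω t := by
  rw [Redraw, Nat.add_sub_cancel] at h
  rw [thresholds, if_pos (not_not.1 h)]

lemma mem_attempt_firstSpanning {t : ℕ} {ω : Seed E} (h : Redraw M a y z t ω) :
    ω ∈ attempt M a y z t (firstSpanning M a z t ω) :=
  ⟨h, fun _ hj => Nat.notMem_of_lt_sInf hj⟩

lemma measurableSet_freshSpanning (s k t : ℕ) :
    MeasurableSet {ω : Seed E | FreshSpanning M a z s k t ω} :=
  measurableSet_fresh_roundAt _ s k (z t) M.Spanning

lemma measurable_firstSpanning (t : ℕ) :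
    Measurable (firstSpanning M a z t : Seed E → ℕ) := by
  refine measurable_to_countable' fun n => ?_
  have h : firstSpanning M a z t ⁻¹' {n} =
      ({ω : Seed E | FreshSpanning M a z t n t ω} ∩
        ⋂ j ∈ Set.Iio n, {ω : Seed E | FreshSpanning M a z t j t ω}ᶜ) ∪
      (if n = 0 then ⋂ j : ℕ, {ω : Seed E | FreshSpanning M a z t j t ω}ᶜ else ∅) := by
    ext ω
    simp only [Set.mem_preimage, Set.mem_singleton_iff, Set.mem_union, Set.mem_inter_iff,
      Set.mem_ofPred_eq, Set.mem_iInter, Set.mem_compl_iff, Set.mem_Iio]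
    constructor
    · rintro rfl
      by_cases hne : {k | FreshSpanning M a z t k t ω}.Nonempty
      · exact Or.inl ⟨Nat.sInf_mem hne, fun j hj => Nat.notMem_of_lt_sInf hj⟩
      · rw [Set.not_nonempty_iff_eq_empty] at hne
        have h0 : firstSpanning M a z t ω = 0 := by rw [firstSpanning, hne, Nat.sInf_empty]
        right
        rw [if_pos h0]
        simp only [Set.mem_iInter, Set.mem_compl_iff, Set.mem_ofPred_eq]
        intro j hj
        exact (Set.ext_iff.1 hne j).1 hj
    · rintro (⟨h1, h2⟩ | h)
      · refine le_antisymm (Nat.sInf_le h1) ?_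
        by_contra hlt
        exact h2 _ (not_le.1 hlt) (Nat.sInf_mem (s := {k | FreshSpanning M a z t k t ω}) ⟨n, h1⟩)
      · split_ifs at h with h0
        · simp only [Set.mem_iInter, Set.mem_compl_iff, Set.mem_ofPred_eq] at h
          have : {k | FreshSpanning M a z t k t ω} = ∅ :=
            Set.eq_empty_of_forall_notMem fun k hk => h k hk
          rw [firstSpanning, this, Nat.sInf_empty, h0]
        · exact h.elim
  rw [h]
  refine ((measurableSet_freshSpanning t n t).inter (MeasurableSet.biInter (Set.to_countable _)
    fun j _ => (measurableSet_freshSpanning t j t).compl)).union ?_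
  split_ifs
  · exact MeasurableSet.iInter fun j => (measurableSet_freshSpanning t j t).compl
  · exact MeasurableSet.empty

lemma measurableSet_redraw_of {t : ℕ} (h : Measurable fun ω => thresholds M a y z ω t) :
    MeasurableSet {ω | Redraw M a y z (t + 1) ω} := by
  by_cases hs : EpochStart M a y (t + 1)
  · simp [Redraw, hs]
  · have : {ω | Redraw M a y z (t + 1) ω} =
        {ω | M.Spanning (roundAt (z (t + 1)) (thresholds M a y z ω t))}ᶜ := by
      ext ω; simp [Redraw, hs]
    rw [this]
    exact (h (measurableSet_roundAt_mem _ M.Spanning)).compl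

lemma measurable_thresholds (t : ℕ) : Measurable fun ω => thresholds M a y z ω t := by
  classical
  induction t with
  | zero => exact measurable_const
  | succ t ih =>
    have h1 : (fun ω => thresholds M a y z ω (t + 1)) = fun ω =>
        if Redraw M a y z (t + 1) ω then
          freshThresholds (bigL M a) ω (t + 1) (firstSpanning M a z (t + 1) ω)
        else thresholds M a y z ω t := by
      funext ω
      split_ifs with h
      · exact thresholds_of_redraw h
      · exact thresholds_of_not_redraw h
    have h2 : Measurable fun p : ℕ × Seed E => freshThresholds (bigL M a) p.2 (t + 1) p.1 :=
      measurable_from_prod_countable_right fun k => measurable_freshThresholds _ _ k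
    rw [h1]
    exact Measurable.ite (measurableSet_redraw_of ih)
      (h2.comp ((measurable_firstSpanning (t + 1)).prodMk measurable_id)) ih

lemma measurableSet_mem_rounding (t : ℕ) (e : E) :
    MeasurableSet {ω | e ∈ rounding M a y z ω t} := by
  by_cases ht : t = 0
  · simp [rounding, ht]
  · simp only [rounding, ht, if_false]
    exact (measurable_thresholds t) (measurableSet_roundAt_mem (z t) fun X => e ∈ X)

lemma measurableSet_attempt (t k : ℕ) : MeasurableSet (attempt M a y z (t + 1) k) := by
  have : attempt M a y z (t + 1) k = {ω | Redraw M a y z (t + 1) ω} ∩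
      ⋂ j ∈ Set.Iio k, {ω : Seed E | FreshSpanning M a z (t + 1) j (t + 1) ω}ᶜ := by
    ext ω; simp [attempt]
  rw [this]
  exact (measurableSet_redraw_of (measurable_thresholds t)).inter (MeasurableSet.biInter
    (Set.to_countable _) fun j _ => (measurableSet_freshSpanning _ j _).compl)

/-- Whether the `k`-th fresh vector at time `t` is considered is independent of that vector. -/
lemma seedLaw_attempt_inter {t : ℕ} (ht : 1 ≤ t) (k : ℕ) {D : Set (E → ℝ)} (hD : MeasurableSet D) :
    seedLaw E (attempt M a y z t k ∩ {ω | freshThresholds (bigL M a) ω t k ∈ D}) =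
      seedLaw E (attempt M a y z t k) *
        seedLaw E {ω | freshThresholds (bigL M a) ω t k ∈ D} := by
  obtain ⟨t, rfl⟩ : ∃ s, t = s + 1 := ⟨t - 1, by omega⟩
  refine seedLaw_inter_of_dependsOn {i | i.1 < t + 1 ∨ i.1 = t + 1 ∧ i.2.1 < k}
    (measurableSet_attempt t k) (measurable_freshThresholds _ _ _ hD) ?_ ?_
  · rintro ω ω' h ⟨h1, h2⟩
    have hth : thresholds M a y z ω t = thresholds M a y z ω' t :=
      thresholds_congr (fun _ _ => ⟨rfl, rfl⟩) fun s hs k e =>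
        h (s, k, e) (Or.inl (Nat.lt_succ_of_le hs))
    refine ⟨?_, fun j hj => ?_⟩
    · rw [Redraw, Nat.add_sub_cancel] at h1 ⊢
      rwa [← hth]
    · have := h2 j hj
      rw [FreshSpanning] at this ⊢
      rwa [← freshThresholds_congr fun e => h (t + 1, j, e) (Or.inr ⟨rfl, hj⟩)]
  · intro ω ω' h h1
    have : freshThresholds (bigL M a) ω (t + 1) k = freshThresholds (bigL M a) ω' (t + 1) k :=
      freshThresholds_congr fun e => h (t + 1, k, e) (by simp)
    rwa [Set.mem_ofPred_eq, ← this]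

/-- At every time `t ≥ 1` the thresholds are the outcome of an attempt in the current epoch, and
have been in force since then. -/
lemma exists_attempt (ω : Seed E) {t : ℕ} (ht : 1 ≤ t) :
    ∃ s k, lastStart M a y t ≤ s ∧ s ≤ t ∧ ω ∈ attempt M a y z s k ∧
      (∀ u, s ≤ u → u ≤ t → thresholds M a y z ω u = freshThresholds (bigL M a) ω s k) := by
  have hredraw : ∀ t, Redraw M a y z (t + 1) ω →
      ∃ s k, lastStart M a y (t + 1) ≤ s ∧ s ≤ t + 1 ∧ ω ∈ attempt M a y z s k ∧
      (∀ u, s ≤ u → u ≤ t + 1 →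
        thresholds M a y z ω u = freshThresholds (bigL M a) ω s k) := by
    intro t h
    refine ⟨t + 1, _, lastStart_le M a y _, le_rfl, mem_attempt_firstSpanning h, fun u h1 h2 => ?_⟩
    obtain rfl : u = t + 1 := le_antisymm h2 h1
    exact thresholds_of_redraw h
  induction t, ht using Nat.le_induction with
  | base => exact hredraw 0 fun h => h.1 (Or.inl rfl)
  | succ t ht ih =>
    by_cases h : Redraw M a y z (t + 1) ω
    · exact hredraw t h
    · obtain ⟨s, k, h1, h2, h3, h4⟩ := ih
      refine ⟨s, k, ?_, by omega, h3, fun u hu1 hu2 => ?_⟩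
      · rwa [lastStart_succ (not_not.1 h).1]
      · rcases hu2.eq_or_lt with rfl | hlt
        · rw [thresholds_of_not_redraw h, h4 t h2 le_rfl]
        · exact h4 u hu1 (by omega)

end Algorithm

/-! ### The expected number of attempts -/

section Attempts

variable {E : Type*} [Fintype E] {M : Matroid E} {a : E → ℝ} {T : ℕ} {y z : ℕ → E → ℝ}

lemma mem_epochBlock_lastStart {t : ℕ} (h1 : 1 ≤ t) (h2 : t ≤ T) :
    t ∈ epochBlock M a y T (lastStart M a y t) := mem_epochBlock.2 ⟨⟨h1, h2⟩, rfl⟩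

lemma seedLaw_not_freshSpanning_le (hE : M.E = Set.univ) (hr : 1 ≤ rankM M)
    (ha : ∀ e, 0 < a e) (h : IsFractional M T y z) {t : ℕ} (h1 : 1 ≤ t) (h2 : t ≤ T) (s k : ℕ) :
    seedLaw E {ω | ¬ FreshSpanning M a z s k t ω} ≤ ENNReal.ofReal (bigR M a)⁻¹ := by
  refine (measure_mono ?_).trans
    (seedLaw_exists_not_spanning_le hE hr ha h (lastStart M a y t) s k)
  exact fun _ hω => ⟨t, mem_epochBlock_lastStart h1 h2, hω⟩

lemma ofReal_inv_bigR_le (hr : 1 ≤ rankM M) (ha : ∀ e, 0 < a e) :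
    ENNReal.ofReal (bigR M a)⁻¹ ≤ 2⁻¹ := by
  have hR := eight_le_bigR (M := M) hr ha
  rw [← ENNReal.ofReal_ofNat 2, ← ENNReal.ofReal_inv_of_pos (by norm_num)]
  exact ENNReal.ofReal_le_ofReal (inv_anti₀ (by norm_num) (by linarith))

lemma seedLaw_attempt_le (hE : M.E = Set.univ) (hr : 1 ≤ rankM M)
    (ha : ∀ e, 0 < a e) (h : IsFractional M T y z) {t : ℕ} (h1 : 1 ≤ t) (h2 : t ≤ T) (k : ℕ) :
    seedLaw E (attempt M a y z t k) ≤ 2⁻¹ ^ k := by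
  induction k with
  | zero => simpa using prob_le_one
  | succ k ih =>
    calc seedLaw E (attempt M a y z t (k + 1))
        ≤ seedLaw E (attempt M a y z t k ∩
          {ω | freshThresholds (bigL M a) ω t k ∈ {τ | ¬ M.Spanning (roundAt (z t) τ)}}) :=
          measure_mono fun ω hω => ⟨⟨hω.1, fun j hj => hω.2 j (by omega)⟩, hω.2 k (by omega)⟩
      _ = seedLaw E (attempt M a y z t k) * seedLaw E {ω | ¬ FreshSpanning M a z t k t ω} :=
          seedLaw_attempt_inter h1 k (measurableSet_roundAt_mem _ fun X => ¬ M.Spanning X)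
      _ ≤ 2⁻¹ ^ k * 2⁻¹ := mul_le_mul' ih
          ((seedLaw_not_freshSpanning_le hE hr ha h h1 h2 t k).trans (ofReal_inv_bigR_le hr ha))
      _ = _ := (pow_succ _ _).symm

/-- Almost surely, the repeated draws end with a spanning set. -/
lemma ae_spanning (hE : M.E = Set.univ) (hr : 1 ≤ rankM M)
    (ha : ∀ e, 0 < a e) (h : IsFractional M T y z) :
    ∀ᵐ ω ∂(seedLaw E), ∀ t ∈ Finset.Icc 1 T,
      M.Spanning (roundAt (z t) (thresholds M a y z ω t)) := by
  rw [ae_all_iff]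
  intro t
  rw [Filter.eventually_imp_distrib_left]
  intro ht
  rw [Finset.mem_Icc] at ht
  have h0 : seedLaw E (⋂ k, attempt M a y z t k) = 0 := by
    refine le_antisymm (ge_of_tendsto' (ENNReal.tendsto_pow_atTop_nhds_zero_of_lt_one
      (r := 2⁻¹) (by simp)) fun k => ?_) (zero_le)
    exact (measure_mono (Set.iInter_subset _ k)).trans (seedLaw_attempt_le hE hr ha h ht.1 ht.2 k)
  refine measure_mono_null (fun ω hω => ?_) h0
  obtain ⟨t, rfl⟩ : ∃ s, t = s + 1 := ⟨t - 1, by omega⟩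
  change ¬ M.Spanning _ at hω
  by_cases hre : Redraw M a y z (t + 1) ω
  · refine Set.mem_iInter.2 fun k => ⟨hre, fun j _ hj => hω ?_⟩
    rw [thresholds_of_redraw hre]
    exact Nat.sInf_mem (s := {k | FreshSpanning M a z (t + 1) k (t + 1) ω}) ⟨j, hj⟩
  · rw [thresholds_of_not_redraw hre] at hω
    exact (hω (not_not.1 hre).2).elim

/-- The expected number of fresh vectors considered at time `t`. -/
def expectedAttempts (M : Matroid E) (a : E → ℝ) (y z : ℕ → E → ℝ) (t : ℕ) : ℝ≥0∞ :=
  ∑' k, seedLaw E (attempt M a y z t k)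

lemma expectedAttempts_le_two (hE : M.E = Set.univ) (hr : 1 ≤ rankM M)
    (ha : ∀ e, 0 < a e) (h : IsFractional M T y z) {t : ℕ} (h1 : 1 ≤ t) (h2 : t ≤ T) :
    expectedAttempts M a y z t ≤ 2 := by
  calc _ ≤ ∑' k : ℕ, (2⁻¹ : ℝ≥0∞) ^ k :=
        ENNReal.tsum_le_tsum fun k => seedLaw_attempt_le hE hr ha h h1 h2 k
    _ = 2 := by rw [ENNReal.tsum_geometric, ENNReal.one_sub_inv_two, inv_inv]

/-- The event that the `k`-th fresh vector at time `s` is spanning from time `s` on, and stops being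
so at time `t`. -/
def failAt (M : Matroid E) (a : E → ℝ) (z : ℕ → E → ℝ) (s k t : ℕ) : Set (Seed E) :=
  {ω | s ≤ t ∧ (∀ u, s ≤ u → u < t → FreshSpanning M a z s k u ω) ∧ ¬ FreshSpanning M a z s k t ω}

/-- The set of threshold vectors with which the event `failAt` happens. -/
def failSet (M : Matroid E) (z : ℕ → E → ℝ) (s t : ℕ) : Set (E → ℝ) :=
  {τ | s ≤ t ∧ (∀ u, s ≤ u → u < t → M.Spanning (roundAt (z u) τ)) ∧ ¬ M.Spanning (roundAt (z t) τ)}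

lemma measurableSet_failSet (s t : ℕ) : MeasurableSet (failSet M z s t) := by
  have : failSet M z s t = {τ | s ≤ t} ∩
      ((⋂ u ∈ Set.Ico s t, {τ | M.Spanning (roundAt (z u) τ)}) ∩
        {τ | M.Spanning (roundAt (z t) τ)}ᶜ) := by
    ext τ; simp [failSet]
  rw [this]
  exact (MeasurableSet.const _).inter ((MeasurableSet.biInter (Set.to_countable _) fun u _ =>
    measurableSet_roundAt_mem (z u) M.Spanning).inter
      (measurableSet_roundAt_mem (z t) M.Spanning).compl)

lemma sum_seedLaw_failAt_le (hE : M.E = Set.univ) (hr : 1 ≤ rankM M)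
    (ha : ∀ e, 0 < a e) (h : IsFractional M T y z) (p s k : ℕ) :
    ∑ t ∈ epochBlock M a y T p, seedLaw E (failAt M a z s k t) ≤
      ENNReal.ofReal (bigR M a)⁻¹ := by
  rw [← measure_biUnion_finset]
  · refine (measure_mono ?_).trans (seedLaw_exists_not_spanning_le hE hr ha h p s k)
    intro ω hω
    simp only [Set.mem_iUnion] at hω
    obtain ⟨t, ht, hω⟩ := hω
    exact ⟨t, ht, hω.2.2⟩
  · intro t _ t' _ hne
    refine Set.disjoint_left.2 fun ω h1 h2 => ?_
    rcases lt_or_gt_of_ne hne with hlt | hlt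
    · exact h1.2.2 (h2.2.1 t h1.1 hlt)
    · exact h2.2.2 (h1.2.1 t' h2.1 hlt)
  · intro t _
    exact measurable_freshThresholds _ _ _ (measurableSet_failSet (M := M) (z := z) s t)

/-- The expected number of attempts at time `t`, not counting the one that every epoch starts
with (`lastStart M a y t = t` says that an epoch starts at time `t`). -/
def extraAttempts (M : Matroid E) (a : E → ℝ) (y z : ℕ → E → ℝ) (t : ℕ) : ℝ≥0∞ :=
  (if lastStart M a y t = t then 0 else seedLaw E (attempt M a y z t 0)) +
    ∑' k, seedLaw E (attempt M a y z t (k + 1))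

lemma expectedAttempts_le (t : ℕ) :
    expectedAttempts M a y z t ≤
      (if lastStart M a y t = t then 1 else 0) + extraAttempts M a y z t := by
  rw [expectedAttempts, tsum_eq_zero_add' ENNReal.summable, extraAttempts, ← add_assoc]
  refine add_le_add_left ?_ _
  split_ifs
  · simpa using prob_le_one
  · simp

/-- Every attempt, except for the first one of an epoch, is due to the failure of an earlier
attempt of this epoch. -/
lemma extraAttempts_le (hE : M.E = Set.univ) (hr : 1 ≤ rankM M)
    (ha : ∀ e, 0 < a e) (h : IsFractional M T y z) {p t : ℕ} (ht : t ∈ epochBlock M a y T p) :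
    extraAttempts M a y z t ≤ ∑ s ∈ epochBlock M a y T p, ∑' k,
      seedLaw E (attempt M a y z s k) * seedLaw E (failAt M a z s k t) := by
  classical
  have ht' := mem_epochBlock.1 ht
  have hind : ∀ s k, 1 ≤ s → seedLaw E (attempt M a y z s k ∩ failAt M a z s k t) =
      seedLaw E (attempt M a y z s k) * seedLaw E (failAt M a z s k t) := fun s k hs =>
    seedLaw_attempt_inter hs k (measurableSet_failSet s t)
  rw [← Finset.sum_erase_add _ _ ht, extraAttempts]
  refine add_le_add ?_ (ENNReal.tsum_le_tsum fun k => ?_)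
  · split_ifs with hst
    · exact zero_le
    have hlt : lastStart M a y t < t := lt_of_le_of_ne (lastStart_le M a y t) hst
    obtain ⟨t, rfl⟩ : ∃ s, t = s + 1 := ⟨t - 1, by omega⟩
    have hns : ¬ EpochStart M a y (t + 1) := not_epochStart_of_lastStart_lt hlt le_rfl
    have hls := lastStart_succ hns
    have ht1 : 1 ≤ t := by
      have := one_le_lastStart (M := M) (a := a) (y := y) ht'.1.1
      omega
    calc seedLaw E (attempt M a y z (t + 1) 0)
        ≤ seedLaw E (⋃ s ∈ (epochBlock M a y T p).erase (t + 1), ⋃ k,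
            attempt M a y z s k ∩ failAt M a z s k (t + 1)) := by
          refine measure_mono_ae ?_
          filter_upwards [ae_spanning hE hr ha h] with ω hω hatt
          obtain ⟨s, k, h1, h2, h3, h4⟩ := exists_attempt (M := M) (a := a) (y := y) (z := z) ω ht1
          have hs1 : 1 ≤ s := (one_le_lastStart ht1).trans h1
          have hsp : lastStart M a y s = p := by
            rw [lastStart_eq_of_le h1 h2, ← hls]; exact ht'.2
          change ω ∈ ⋃ s ∈ (epochBlock M a y T p).erase (t + 1), ⋃ k,
            attempt M a y z s k ∩ failAt M a z s k (t + 1)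
          simp only [Set.mem_iUnion]
          refine ⟨s, Finset.mem_erase.2 ⟨by omega, mem_epochBlock.2 ⟨⟨hs1, by omega⟩, hsp⟩⟩, k, h3,
            by omega, fun u hu1 hu2 => ?_, fun hsp => ?_⟩
          · rw [FreshSpanning, ← h4 u hu1 (by omega)]
            exact hω u (Finset.mem_Icc.2 ⟨by omega, by omega⟩)
          · refine hatt.1 ⟨hns, ?_⟩
            rw [Nat.add_sub_cancel, h4 t h2 le_rfl]
            exact hsp
      _ ≤ ∑ s ∈ (epochBlock M a y T p).erase (t + 1), ∑' k,
            seedLaw E (attempt M a y z s k ∩ failAt M a z s k (t + 1)) :=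
          (measure_biUnion_finset_le _ _).trans
            (Finset.sum_le_sum fun s _ => measure_iUnion_le _)
      _ = _ := by
          refine Finset.sum_congr rfl fun s hs => tsum_congr fun k => ?_
          exact hind s k (mem_epochBlock.1 (Finset.mem_erase.1 hs).2).1.1
  · rw [← hind t k ht'.1.1]
    refine measure_mono fun ω hω => ⟨⟨hω.1, fun j hj => hω.2 j (by omega)⟩, le_rfl,
      fun u h1 h2 => absurd h2 (by omega), hω.2 k (by omega)⟩

lemma sum_extraAttempts_le_mul (hE : M.E = Set.univ) (hr : 1 ≤ rankM M)
    (ha : ∀ e, 0 < a e) (h : IsFractional M T y z) (p : ℕ) :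
    ∑ t ∈ epochBlock M a y T p, extraAttempts M a y z t ≤
      ENNReal.ofReal (bigR M a)⁻¹ * ∑ t ∈ epochBlock M a y T p, expectedAttempts M a y z t := by
  calc _ ≤ ∑ t ∈ epochBlock M a y T p, ∑ s ∈ epochBlock M a y T p, ∑' k,
        seedLaw E (attempt M a y z s k) * seedLaw E (failAt M a z s k t) :=
        Finset.sum_le_sum fun t ht => extraAttempts_le hE hr ha h ht
    _ = ∑ s ∈ epochBlock M a y T p, ∑' k, seedLaw E (attempt M a y z s k) *
          ∑ t ∈ epochBlock M a y T p, seedLaw E (failAt M a z s k t) := by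
        rw [Finset.sum_comm]
        refine Finset.sum_congr rfl fun s _ => ?_
        rw [← Summable.tsum_finsetSum fun _ _ => ENNReal.summable]
        simp only [Finset.mul_sum]
    _ ≤ ∑ s ∈ epochBlock M a y T p, ∑' k, seedLaw E (attempt M a y z s k) *
          ENNReal.ofReal (bigR M a)⁻¹ :=
        Finset.sum_le_sum fun s _ => ENNReal.tsum_le_tsum fun k =>
          mul_le_mul_right (sum_seedLaw_failAt_le hE hr ha h p s k) _
    _ = _ := by
        rw [Finset.mul_sum]
        refine Finset.sum_congr rfl fun s _ => ?_
        rw [ENNReal.tsum_mul_right, mul_comm, expectedAttempts]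

/-- The expected number of attempts in an epoch is at most `2`. -/
lemma sum_expectedAttempts_le (hE : M.E = Set.univ) (hr : 1 ≤ rankM M)
    (ha : ∀ e, 0 < a e) (h : IsFractional M T y z) (p : ℕ) :
    ∑ t ∈ epochBlock M a y T p, expectedAttempts M a y z t ≤ 2 := by
  set N := ∑ t ∈ epochBlock M a y T p, expectedAttempts M a y z t with hN
  have hfin : N ≠ ∞ := by
    refine (ENNReal.sum_lt_top.2 fun t ht => ?_).ne
    have := (mem_epochBlock.1 ht).1
    exact (expectedAttempts_le_two hE hr ha h this.1 this.2).trans_lt (by simp)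
  have hN1 : N ≤ 1 + 2⁻¹ * N := by
    calc N ≤ ∑ t ∈ epochBlock M a y T p,
          ((if lastStart M a y t = t then 1 else 0) + extraAttempts M a y z t) :=
          Finset.sum_le_sum fun t _ => expectedAttempts_le t
      _ = ∑ t ∈ epochBlock M a y T p, (if lastStart M a y t = t then 1 else 0) +
          ∑ t ∈ epochBlock M a y T p, extraAttempts M a y z t := Finset.sum_add_distrib
      _ ≤ _ := by
          refine add_le_add ?_ ((sum_extraAttempts_le_mul hE hr ha h p).trans
            (mul_le_mul_left (ofReal_inv_bigR_le hr ha) _))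
          calc _ = ∑ t ∈ epochBlock M a y T p, (if p = t then (1 : ℝ≥0∞) else 0) :=
                Finset.sum_congr rfl fun t ht => by rw [(mem_epochBlock.1 ht).2]
            _ ≤ 1 := by rw [Finset.sum_ite_eq]; split_ifs <;> simp
  have h2 : N = 2⁻¹ * N + 2⁻¹ * N := by
    rw [← add_mul, ENNReal.inv_two_add_inv_two, one_mul]
  have h3 : 2⁻¹ * N ≤ 1 := by
    refine (ENNReal.add_le_add_iff_right (a := 2⁻¹ * N)
      (ENNReal.mul_ne_top (by simp) hfin)).1 ?_
    rwa [← h2]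
  calc N = 2⁻¹ * N + 2⁻¹ * N := h2
    _ ≤ 1 + 1 := add_le_add h3 h3
    _ = 2 := one_add_one_eq_two

lemma sum_extraAttempts_le (hE : M.E = Set.univ) (hr : 1 ≤ rankM M)
    (ha : ∀ e, 0 < a e) (h : IsFractional M T y z) (p : ℕ) :
    ∑ t ∈ epochBlock M a y T p, extraAttempts M a y z t ≤
      ENNReal.ofReal (bigR M a)⁻¹ * 2 :=
  (sum_extraAttempts_le_mul hE hr ha h p).trans
    (mul_le_mul_right (sum_expectedAttempts_le hE hr ha h p) _)

end Attempts

/-! ### The expected cost of the rounding -/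

section Cost

variable {E : Type*} [Fintype E] {M : Matroid E} {a : E → ℝ} {T : ℕ} {y z : ℕ → E → ℝ}

lemma expectedCost_eq (M : Matroid E) (a : E → ℝ) (c : ℕ → E → ℝ≥0∞) (T : ℕ)
    (y z : ℕ → E → ℝ) :
    expectedCost M a c T y z = ∑ t ∈ Finset.Icc 1 T,
      (∑ e, c t e * seedLaw E {ω | e ∈ rounding M a y z ω t} +
        ∑ e, ENNReal.ofReal (a e) *
          seedLaw E {ω | e ∈ rounding M a y z ω t \ rounding M a y z ω (t - 1)}) := by
  classical
  have hm : ∀ t e, MeasurableSet {ω | e ∈ rounding M a y z ω t \ rounding M a y z ω (t - 1)} :=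
    fun t e => (measurableSet_mem_rounding t e).diff (measurableSet_mem_rounding (t - 1) e)
  have hite : ∀ (b : ℝ≥0∞) (P : Seed E → Prop) [DecidablePred P], MeasurableSet {ω | P ω} →
      Measurable fun ω => if P ω then b else 0 := fun b P _ hP =>
    Measurable.ite hP measurable_const measurable_const
  have hint : ∀ (b : ℝ≥0∞) (P : Seed E → Prop) [DecidablePred P], MeasurableSet {ω | P ω} →
      ∫⁻ ω, (if P ω then b else 0) ∂(seedLaw E) = b * seedLaw E {ω | P ω} := fun b P _ hP => by
    rw [← lintegral_indicator_const hP b]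
    refine lintegral_congr fun ω => ?_
    simp [Set.indicator_apply]
  simp only [expectedCost, msmCost]
  rw [lintegral_finsetSum]
  · refine Finset.sum_congr rfl fun t _ => ?_
    rw [lintegral_add_left, lintegral_finsetSum, lintegral_finsetSum]
    · congr 1
      · exact Finset.sum_congr rfl fun e _ => by
          rw [← hint _ _ (measurableSet_mem_rounding t e)]
      · exact Finset.sum_congr rfl fun e _ => by rw [← hint _ _ (hm t e)]
    · exact fun e _ => hite _ _ (hm t e)
    · exact fun e _ => hite _ _ (measurableSet_mem_rounding t e)
    · exact Finset.measurable_sum _ fun e _ => hite _ _ (measurableSet_mem_rounding t e)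
  · exact fun t _ => (Finset.measurable_sum _ fun e _ =>
      hite _ _ (measurableSet_mem_rounding t e)).add
        (Finset.measurable_sum _ fun e _ => hite _ _ (hm t e))

/-- An event of probability at most `q` for fresh thresholds has probability at most `2 q` for the
thresholds in force, since an epoch has at most two attempts in expectation. -/
lemma seedLaw_thresholds_mem_le (hE : M.E = Set.univ) (hr : 1 ≤ rankM M)
    (ha : ∀ e, 0 < a e) (h : IsFractional M T y z) {t : ℕ} (h1 : 1 ≤ t) (h2 : t ≤ T)
    {D : Set (E → ℝ)} (hD : MeasurableSet D) {q : ℝ≥0∞}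
    (hq : ∀ s k, seedLaw E {ω | freshThresholds (bigL M a) ω s k ∈ D} ≤ q) :
    seedLaw E {ω | thresholds M a y z ω t ∈ D} ≤ 2 * q := by
  set B := epochBlock M a y T (lastStart M a y t) with hB
  calc _ ≤ seedLaw E (⋃ s ∈ B, ⋃ k, attempt M a y z s k ∩
        {ω | freshThresholds (bigL M a) ω s k ∈ D}) := by
        refine measure_mono fun ω hω => ?_
        obtain ⟨s, k, hs1, hs2, hatt, hth⟩ :=
          exists_attempt (M := M) (a := a) (y := y) (z := z) ω h1
        simp only [Set.mem_iUnion]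
        refine ⟨s, mem_epochBlock.2 ⟨⟨(one_le_lastStart h1).trans hs1, by omega⟩,
          lastStart_eq_of_le hs1 hs2⟩, k, hatt, ?_⟩
        rw [Set.mem_ofPred_eq, ← hth t hs2 le_rfl]
        exact hω
    _ ≤ ∑ s ∈ B, ∑' k, seedLaw E (attempt M a y z s k ∩
        {ω | freshThresholds (bigL M a) ω s k ∈ D}) :=
        (measure_biUnion_finset_le _ _).trans (Finset.sum_le_sum fun s _ => measure_iUnion_le _)
    _ ≤ ∑ s ∈ B, expectedAttempts M a y z s * q := by
        refine Finset.sum_le_sum fun s hs => ?_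
        rw [expectedAttempts, ← ENNReal.tsum_mul_right]
        refine ENNReal.tsum_le_tsum fun k => ?_
        rw [seedLaw_attempt_inter (mem_epochBlock.1 hs).1.1 k hD]
        exact mul_le_mul_right (hq s k) _
    _ ≤ 2 * q := by
        rw [← Finset.sum_mul]
        exact mul_le_mul_left (sum_expectedAttempts_le hE hr ha h _) _

lemma seedLaw_redraw_inter_le {t : ℕ} (h1 : 1 ≤ t) {D : Set (E → ℝ)} (hD : MeasurableSet D)
    {q : ℝ≥0∞} (hq : ∀ k, seedLaw E {ω | freshThresholds (bigL M a) ω t k ∈ D} ≤ q) :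
    seedLaw E {ω | Redraw M a y z t ω ∧ thresholds M a y z ω t ∈ D} ≤
      expectedAttempts M a y z t * q := by
  calc _ ≤ seedLaw E (⋃ k, attempt M a y z t k ∩
        {ω | freshThresholds (bigL M a) ω t k ∈ D}) := by
        refine measure_mono fun ω hω => ?_
        refine Set.mem_iUnion.2 ⟨_, mem_attempt_firstSpanning hω.1, ?_⟩
        obtain ⟨t, rfl⟩ : ∃ s, t = s + 1 := ⟨t - 1, by omega⟩
        rw [Set.mem_ofPred_eq, ← thresholds_of_redraw hω.1]
        exact hω.2
    _ ≤ ∑' k, seedLaw E (attempt M a y z t k ∩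
        {ω | freshThresholds (bigL M a) ω t k ∈ D}) := measure_iUnion_le _
    _ ≤ _ := by
        rw [expectedAttempts, ← ENNReal.tsum_mul_right]
        refine ENNReal.tsum_le_tsum fun k => ?_
        rw [seedLaw_attempt_inter h1 k hD]
        exact mul_le_mul_right (hq k) _

lemma seedLaw_mem_rounding_le (hE : M.E = Set.univ) (hr : 1 ≤ rankM M)
    (ha : ∀ e, 0 < a e) (h : IsFractional M T y z) {t : ℕ} (h1 : 1 ≤ t) (h2 : t ≤ T) (e : E) :
    seedLaw E {ω | e ∈ rounding M a y z ω t} ≤ 2 * ENNReal.ofReal (bigL M a * z t e) := by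
  have ht : t ≠ 0 := by omega
  simp only [rounding, ht, if_false]
  exact seedLaw_thresholds_mem_le hE hr ha h h1 h2 (D := {τ | e ∈ roundAt (z t) τ})
    (measurableSet_roundAt_mem (z t) fun X => e ∈ X)
    fun s k => seedLaw_mem_roundAt_le (bigL_pos hr ha) (z t) s k e

/-- An element is acquired either because its fractional value passes its threshold, or in a
redraw. -/
lemma seedLaw_acquire_le (hE : M.E = Set.univ) (hr : 1 ≤ rankM M)
    (ha : ∀ e, 0 < a e) (h : IsFractional M T y z) {t : ℕ} (h1 : 1 ≤ t) (h2 : t ≤ T) (e : E) :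
    seedLaw E {ω | e ∈ rounding M a y z ω t \ rounding M a y z ω (t - 1)} ≤
      2 * ENNReal.ofReal (bigL M a * y t e) +
        expectedAttempts M a y z t * ENNReal.ofReal (bigL M a * z t e) := by
  have hL := bigL_pos (M := M) hr ha
  set D : Set (E → ℝ) := {τ | e ∈ roundAt (z t) τ \ roundAt (z (t - 1)) τ} with hD
  set D' : Set (E → ℝ) := {τ | e ∈ roundAt (z t) τ} with hD'
  have hmD' : MeasurableSet D' := measurableSet_roundAt_mem (z t) fun X => e ∈ X
  have hmD : MeasurableSet D :=
    hmD'.diff (measurableSet_roundAt_mem (z (t - 1)) fun X => e ∈ X)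
  calc _ ≤ seedLaw E ({ω | thresholds M a y z ω t ∈ D} ∪
        {ω | Redraw M a y z t ω ∧ thresholds M a y z ω t ∈ D'}) := by
        refine measure_mono fun ω hω => ?_
        obtain ⟨t, rfl⟩ : ∃ s, t = s + 1 := ⟨t - 1, by omega⟩
        have hin : e ∈ roundAt (z (t + 1)) (thresholds M a y z ω (t + 1)) := by
          simpa [rounding] using hω.1
        by_cases hre : Redraw M a y z (t + 1) ω
        · exact Or.inr ⟨hre, hin⟩
        · refine Or.inl ⟨hin, fun hmem => hω.2 ?_⟩
          -- The first timestep starts an epoch, so the thresholds are not kept there.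
          have ht : t ≠ 0 := by
            rintro rfl
            exact (not_not.1 hre).1 (Or.inl rfl)
          rw [thresholds_of_not_redraw hre] at hmem
          simpa [rounding, ht] using hmem
    _ ≤ _ := by
        refine (measure_union_le _ _).trans (add_le_add ?_ ?_)
        · refine seedLaw_thresholds_mem_le hE hr ha h h1 h2 hmD fun s k => ?_
          refine (seedLaw_mem_roundAt_diff_le hL (z t) (z (t - 1)) s k e).trans
            (ENNReal.ofReal_le_ofReal ?_)
          exact mul_le_mul_of_nonneg_left (h.y_ge t (Finset.mem_Icc.2 ⟨h1, h2⟩) e) hL.le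
        · exact seedLaw_redraw_inter_le h1 hmD' fun k => seedLaw_mem_roundAt_le hL (z t) t k e

open scoped Classical in
/-- The costs of the completed epochs and of the current one add up to the total fractional
acquisition cost. -/
lemma sum_epochCost_add (M : Matroid E) (a : E → ℝ) (y : ℕ → E → ℝ) (t : ℕ) :
    ∑ p ∈ Finset.Icc 1 t, (if EpochStart M a y p then epochCost M a y (p - 1) else 0) +
      epochCost M a y t = ∑ s ∈ Finset.Icc 1 t, acquisition a y s := by
  induction t with
  | zero => simp [epochCost]
  | succ t ih =>
    rw [Finset.sum_Icc_succ_top (by omega), Finset.sum_Icc_succ_top (by omega), ← ih,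
      Nat.add_sub_cancel, epochCost, ← acquisition]
    have h : (if EpochStart M a y (t + 1) then epochCost M a y t else 0) +
        (if rankM M * aMax a ≤ epochCost M a y t then 0 else epochCost M a y t) =
        epochCost M a y t := by
      by_cases h1 : rankM M * aMax a ≤ epochCost M a y t
      · rw [if_pos (show EpochStart M a y (t + 1) from Or.inr (by simpa using h1)), if_pos h1,
          add_zero]
      · rw [if_neg h1]
        rcases Nat.eq_zero_or_pos t with rfl | ht
        · simp [epochCost]
        · rw [if_neg, zero_add]
          rw [EpochStart, not_or]
          exact ⟨by omega, by simpa using h1⟩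
    linarith

lemma sum_mul_z_le (h : IsFractional M T y z) {t : ℕ} (h1 : 1 ≤ t)
    (h2 : t ≤ T) : ∑ e, a e * z t e ≤ rankM M * aMax a := by
  have hz := h.z_mem t (Finset.mem_Icc.2 ⟨h1, h2⟩)
  rw [← hz.2.2, Finset.sum_mul]
  refine Finset.sum_le_sum fun e _ => ?_
  rw [mul_comm]
  exact mul_le_mul_of_nonneg_left (le_aMax a e) (hz.1 e)

lemma rankM_mul_aMin_le (h : IsFractional M T y z) {t : ℕ} (h1 : 1 ≤ t)
    (h2 : t ≤ T) : rankM M * aMin a ≤ ∑ e, a e * z t e := by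
  have hz := h.z_mem t (Finset.mem_Icc.2 ⟨h1, h2⟩)
  rw [← hz.2.2, Finset.sum_mul]
  refine Finset.sum_le_sum fun e _ => ?_
  rw [mul_comm (a e)]
  exact mul_le_mul_of_nonneg_left (aMin_le a e) (hz.1 e)

lemma sum_mul_z_one_le (ha : ∀ e, 0 < a e) (h : IsFractional M T y z) (hT : 1 ≤ T) :
    ∑ e, a e * z 1 e ≤ acquisition a y 1 := by
  refine Finset.sum_le_sum fun e _ => mul_le_mul_of_nonneg_left ?_ (ha e).le
  have := h.y_ge 1 (Finset.mem_Icc.2 ⟨le_rfl, hT⟩) e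
  simpa [h.z_zero] using this

/-- In the first epoch, the first attempt is paid for by the acquisitions at time `1`, and the
others are so unlikely that a lower bound on these acquisitions pays for them. -/
lemma sum_first_block_le (hE : M.E = Set.univ) (hr : 1 ≤ rankM M)
    (ha : ∀ e, 0 < a e) (h : IsFractional M T y z) (hT : 1 ≤ T) :
    ∑ t ∈ epochBlock M a y T 1, expectedAttempts M a y z t * ENNReal.ofReal (∑ e, a e * z t e) ≤
      2 * ENNReal.ofReal (acquisition a y 1) := by
  classical
  have := nonempty_of_one_le_rankM hr
  have hamin := aMin_pos ha
  have hR := eight_le_bigR (M := M) hr ha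
  have h1mem : 1 ∈ epochBlock M a y T 1 :=
    mem_epochBlock.2 ⟨⟨le_rfl, hT⟩, lastStart_eq_self (Or.inl rfl)⟩
  calc _ ≤ ∑ t ∈ epochBlock M a y T 1,
        ((if t = 1 then ENNReal.ofReal (∑ e, a e * z t e) else 0) +
          extraAttempts M a y z t * ENNReal.ofReal (rankM M * aMax a)) := by
        refine Finset.sum_le_sum fun t ht => ?_
        have ht' := mem_epochBlock.1 ht
        refine (mul_le_mul_left (expectedAttempts_le t) _).trans ?_
        rw [add_mul, ht'.2]
        refine add_le_add ?_ (mul_le_mul_right (ENNReal.ofReal_le_ofReal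
          (sum_mul_z_le h ht'.1.1 ht'.1.2)) _)
        rw [ite_mul, one_mul, zero_mul]
        simp only [eq_comm, le_refl]
    _ = ENNReal.ofReal (∑ e, a e * z 1 e) + (∑ t ∈ epochBlock M a y T 1,
          extraAttempts M a y z t) * ENNReal.ofReal (rankM M * aMax a) := by
        rw [Finset.sum_add_distrib, ← Finset.sum_mul, Finset.sum_ite_eq', if_pos h1mem]
    _ ≤ ENNReal.ofReal (acquisition a y 1) + ENNReal.ofReal (acquisition a y 1) := by
        refine add_le_add (ENNReal.ofReal_le_ofReal (sum_mul_z_one_le ha h hT)) ?_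
        refine (mul_le_mul_left (sum_extraAttempts_le hE hr ha h 1) _).trans ?_
        rw [← ENNReal.ofReal_ofNat 2, ← ENNReal.ofReal_mul (by positivity),
          ← ENNReal.ofReal_mul (by positivity)]
        refine ENNReal.ofReal_le_ofReal (le_trans ?_
          ((rankM_mul_aMin_le h le_rfl hT).trans (sum_mul_z_one_le ha h hT)))
        have h1 : (rankM M : ℝ) * aMax a = bigR M a * (aMin a / 8) := by
          linarith [aMin_mul_bigR (M := M) hr ha]
        have h2 : (1 : ℝ) ≤ rankM M := by exact_mod_cast hr
        rw [h1, show (bigR M a)⁻¹ * 2 * (bigR M a * (aMin a / 8)) = aMin a / 4 by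
          field_simp; norm_num]
        nlinarith
    _ = _ := (two_mul _).symm

/-- Every later epoch is paid for by the epoch before it. -/
lemma sum_later_block_le (hE : M.E = Set.univ) (hr : 1 ≤ rankM M)
    (ha : ∀ e, 0 < a e) (h : IsFractional M T y z) {p : ℕ} (hp : p ≠ 1)
    (hs : EpochStart M a y p) :
    ∑ t ∈ epochBlock M a y T p, expectedAttempts M a y z t * ENNReal.ofReal (∑ e, a e * z t e) ≤
      2 * ENNReal.ofReal (epochCost M a y (p - 1)) := by
  calc _ ≤ ∑ t ∈ epochBlock M a y T p,
        expectedAttempts M a y z t * ENNReal.ofReal (rankM M * aMax a) := by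
        refine Finset.sum_le_sum fun t ht => ?_
        have ht' := mem_epochBlock.1 ht
        exact mul_le_mul_right (ENNReal.ofReal_le_ofReal (sum_mul_z_le h ht'.1.1 ht'.1.2)) _
    _ ≤ _ := by
        rw [← Finset.sum_mul]
        exact mul_le_mul' (sum_expectedAttempts_le hE hr ha h p)
          (ENNReal.ofReal_le_ofReal (hs.resolve_left hp))

lemma sum_redraw_cost_le (hE : M.E = Set.univ) (hr : 1 ≤ rankM M)
    (ha : ∀ e, 0 < a e) (h : IsFractional M T y z) :
    ∑ t ∈ Finset.Icc 1 T, expectedAttempts M a y z t * ENNReal.ofReal (∑ e, a e * z t e) ≤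
      4 * ENNReal.ofReal (∑ t ∈ Finset.Icc 1 T, acquisition a y t) := by
  classical
  rcases Nat.eq_zero_or_pos T with rfl | hT
  · simp
  have hec : ∀ p ∈ Finset.Icc 1 T,
      0 ≤ if EpochStart M a y p then epochCost M a y (p - 1) else 0 := by
    intro p hp
    split_ifs
    · exact epochCost_nonneg ha h (by have := Finset.mem_Icc.1 hp; omega)
    · exact le_rfl
  have hacq : ∀ t ∈ Finset.Icc 1 T, 0 ≤ acquisition a y t := fun t ht =>
    acquisition_nonneg ha h (Finset.mem_Icc.1 ht).1 (Finset.mem_Icc.1 ht).2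
  have h1mem : 1 ∈ Finset.Icc 1 T := Finset.mem_Icc.2 ⟨le_rfl, hT⟩
  calc _ = ∑ p ∈ Finset.Icc 1 T, ∑ t ∈ epochBlock M a y T p,
        expectedAttempts M a y z t * ENNReal.ofReal (∑ e, a e * z t e) := by
        refine (Finset.sum_fiberwise_of_maps_to (fun t ht => ?_) _).symm
        have := Finset.mem_Icc.1 ht
        exact Finset.mem_Icc.2 ⟨one_le_lastStart this.1, (lastStart_le M a y t).trans this.2⟩
    _ ≤ ∑ p ∈ Finset.Icc 1 T, 2 * ENNReal.ofReal ((if p = 1 then acquisition a y 1 else 0) +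
        if EpochStart M a y p then epochCost M a y (p - 1) else 0) := by
        refine Finset.sum_le_sum fun p hp => ?_
        by_cases hp1 : p = 1
        · subst hp1
          refine (sum_first_block_le hE hr ha h hT).trans ?_
          rw [if_pos rfl]
          exact mul_le_mul_right (ENNReal.ofReal_le_ofReal
            (le_add_of_nonneg_right (hec 1 hp))) _
        · rw [if_neg hp1, zero_add]
          by_cases hs : EpochStart M a y p
          · rw [if_pos hs]
            exact sum_later_block_le hE hr ha h hp1 hs
          · rw [Finset.sum_eq_zero]
            · exact zero_le
            · intro t ht
              have ht' := mem_epochBlock.1 ht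
              rw [← ht'.2] at hs
              exact absurd (epochStart_lastStart ht'.1.1) hs
    _ = 2 * ENNReal.ofReal (acquisition a y 1 + ∑ p ∈ Finset.Icc 1 T,
        if EpochStart M a y p then epochCost M a y (p - 1) else 0) := by
        rw [← Finset.mul_sum, ← ENNReal.ofReal_sum_of_nonneg, Finset.sum_add_distrib,
          Finset.sum_ite_eq', if_pos h1mem]
        intro p hp
        refine add_nonneg ?_ (hec p hp)
        split_ifs
        · exact hacq 1 h1mem
        · exact le_rfl
    _ ≤ 2 * ENNReal.ofReal (2 * ∑ t ∈ Finset.Icc 1 T, acquisition a y t) := by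
        refine mul_le_mul_right (ENNReal.ofReal_le_ofReal ?_) _
        have h1 := sum_epochCost_add M a y T
        have h2 := epochCost_nonneg (M := M) ha h (le_refl T)
        have h3 := Finset.single_le_sum hacq h1mem
        linarith
    _ = _ := by
        rw [ENNReal.ofReal_mul (by norm_num), ENNReal.ofReal_ofNat, ← mul_assoc]
        norm_num

/-- The rounding loses a factor of at most `6 L'`. -/
theorem expectedCost_le (hE : M.E = Set.univ) (hr : 1 ≤ rankM M)
    (ha : ∀ e, 0 < a e) (h : IsFractional M T y z) (c : ℕ → E → ℝ≥0∞) :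
    expectedCost M a c T y z ≤ ENNReal.ofReal (6 * bigL M a) * lpCost a c T y z := by
  have hL := bigL_pos (M := M) hr ha
  set Λ := ENNReal.ofReal (bigL M a) with hΛ
  set A := ∑ t ∈ Finset.Icc 1 T, ∑ e, ENNReal.ofReal (a e * y t e) with hA
  set H := ∑ t ∈ Finset.Icc 1 T, ∑ e, c t e * ENNReal.ofReal (z t e) with hH
  have hAeq : ENNReal.ofReal (∑ t ∈ Finset.Icc 1 T, acquisition a y t) = A := by
    rw [ENNReal.ofReal_sum_of_nonneg fun t ht =>
      acquisition_nonneg ha h (Finset.mem_Icc.1 ht).1 (Finset.mem_Icc.1 ht).2]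
    exact Finset.sum_congr rfl fun t ht => ENNReal.ofReal_sum_of_nonneg fun e _ =>
      mul_nonneg (ha e).le (h.y_nonneg t ht e)
  have hstep : ∀ t ∈ Finset.Icc 1 T,
      (∑ e, c t e * seedLaw E {ω | e ∈ rounding M a y z ω t} +
        ∑ e, ENNReal.ofReal (a e) *
          seedLaw E {ω | e ∈ rounding M a y z ω t \ rounding M a y z ω (t - 1)}) ≤
      2 * Λ * ∑ e, c t e * ENNReal.ofReal (z t e) +
        (2 * Λ * ∑ e, ENNReal.ofReal (a e * y t e) +
          Λ * (expectedAttempts M a y z t * ENNReal.ofReal (∑ e, a e * z t e))) := by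
    intro t ht
    obtain ⟨h1, h2⟩ := Finset.mem_Icc.1 ht
    rw [ENNReal.ofReal_sum_of_nonneg fun e _ => mul_nonneg (ha e).le ((h.z_mem t ht).1 e)]
    refine add_le_add ?_ ?_
    · rw [Finset.mul_sum]
      refine Finset.sum_le_sum fun e _ => ?_
      refine (mul_le_mul_right (seedLaw_mem_rounding_le hE hr ha h h1 h2 e) _).trans_eq ?_
      rw [ENNReal.ofReal_mul hL.le]
      ring
    · simp only [Finset.mul_sum]
      rw [← Finset.sum_add_distrib]
      refine Finset.sum_le_sum fun e _ => ?_
      refine (mul_le_mul_right (seedLaw_acquire_le hE hr ha h h1 h2 e) _).trans_eq ?_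
      rw [ENNReal.ofReal_mul hL.le, ENNReal.ofReal_mul hL.le, ENNReal.ofReal_mul (ha e).le,
        ENNReal.ofReal_mul (ha e).le]
      ring
  calc _ ≤ 2 * Λ * H + (2 * Λ * A + Λ * ∑ t ∈ Finset.Icc 1 T,
          (expectedAttempts M a y z t * ENNReal.ofReal (∑ e, a e * z t e))) := by
        rw [expectedCost_eq]
        refine (Finset.sum_le_sum hstep).trans_eq ?_
        rw [Finset.sum_add_distrib, Finset.sum_add_distrib, ← Finset.mul_sum, ← Finset.mul_sum,
          ← Finset.mul_sum]
    _ ≤ 2 * Λ * H + (2 * Λ * A + Λ * (4 * A)) := by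
        rw [← hAeq]
        gcongr
        exact sum_redraw_cost_le hE hr ha h
    _ = 6 * Λ * A + 2 * Λ * H := by ring
    _ ≤ 6 * Λ * A + 6 * Λ * H := by
        gcongr
        norm_num
    _ = _ := by
        rw [lpCost, ENNReal.ofReal_mul (by norm_num), ENNReal.ofReal_ofNat, ← mul_add]

end Cost

/-! ### Integral solutions as fractional solutions -/

section Integral

variable {E : Type*} [Fintype E] {M : Matroid E} {T : ℕ}

omit [Fintype E] in
/-- The greedy choice of bases within given sets, where elements are kept as long as they are
available. -/
lemma exists_isBasis_sequence (hE : M.E = Set.univ) (S : ℕ → Set E) (h0 : S 0 = ∅) :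
    ∃ B : ℕ → Set E, (∀ t, M.IsBasis (B t) (S t)) ∧ ∀ t, B t ∩ S (t + 1) ⊆ B (t + 1) := by
  have hstep : ∀ (t : ℕ) (I : {I : Set E // M.Indep I}),
      ∃ J : Set E, M.IsBasis J (S (t + 1)) ∧ (I : Set E) ∩ S (t + 1) ⊆ J := fun t I =>
    (I.2.subset Set.inter_subset_left).subset_isBasis_of_subset Set.inter_subset_right
      (by simp [hE])
  choose J hJ1 hJ2 using hstep
  let B : ℕ → {I : Set E // M.Indep I} := fun t =>
    Nat.rec (motive := fun _ => {I : Set E // M.Indep I}) ⟨∅, M.empty_indep⟩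
      (fun t I => ⟨J t I, (hJ1 t I).indep⟩) t
  have hkeep : ∀ t, (B t : Set E) ∩ S (t + 1) ⊆ (B (t + 1) : Set E) := fun t => hJ2 t (B t)
  refine ⟨fun t => B t, fun t => ?_, hkeep⟩
  cases t with
  | zero => rw [h0]; exact M.empty_indep.isBasis_self
  | succ t => exact hJ1 t (B t)

open scoped Classical in
lemma indicator_mem_basePolytope {B S : Set E} (hB : M.IsBasis B S) (hS : M.Spanning S) :
    (fun e => if e ∈ B then (1 : ℝ) else 0) ∈ basePolytope M := by
  have hcard : ∀ X : Finset E, ((X.filter (· ∈ B)).card : ℕ∞) = (B ∩ X : Set E).encard := by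
    intro X
    rw [← Set.encard_coe_eq_coe_finsetCard]
    congr 1
    ext e
    simp [and_comm]
  refine ⟨fun e => by dsimp only; split_ifs <;> norm_num, fun X => ?_, ?_⟩
  · rw [← Finset.sum_filter, Finset.sum_const, nsmul_one]
    have h := (hB.indep.subset Set.inter_subset_left).encard_le_eRk_of_subset
      (Set.inter_subset_right (s := B) (t := (X : Set E)))
    rw [← hcard, ← coe_rankOf] at h
    exact_mod_cast h
  · rw [← Finset.sum_filter, Finset.sum_const, nsmul_one]
    have h := hcard Finset.univ
    rw [Finset.coe_univ, Set.inter_univ, hB.encard_eq_eRk, hS.eRk_eq, ← coe_rankM] at h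
    exact_mod_cast h

open scoped Classical in
/-- The linear program is a relaxation: the bases maintained greedily inside an integral solution
cost no more than that solution. -/
lemma exists_fractional_lpCost_le (hE : M.E = Set.univ) (a : E → ℝ)
    (c : ℕ → E → ℝ≥0∞) {S : ℕ → Set E} (hS : IsMSM M T S) :
    ∃ y z : ℕ → E → ℝ, IsFractional M T y z ∧ lpCost a c T y z ≤ msmCost a c T S := by
  obtain ⟨B, hB, hkeep⟩ := exists_isBasis_sequence hE S hS.1
  have hBS : ∀ t, B t ⊆ S t := fun t => (hB t).subset
  have hB0 : B 0 = ∅ := Set.subset_eq_empty (hBS 0) hS.1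
  set z : ℕ → E → ℝ := fun t e => if e ∈ B t then 1 else 0 with hz
  set y : ℕ → E → ℝ := fun t e => max (z t e - z (t - 1) e) 0 with hy
  refine ⟨y, z, ⟨?_, fun t ht => indicator_mem_basePolytope (hB t) (hS.2 t ht),
    fun t _ e => le_max_right _ _, fun t _ e => le_max_left _ _⟩, ?_⟩
  · funext e
    simp [hz, hB0]
  -- An element that is held by the integral solution but not by the base has been paid for only
  -- by the former; this credit pays when the base takes it later.
  have hpot : ∀ e t, ∑ s ∈ Finset.Icc 1 t, ENNReal.ofReal (a e * y s e) +
      (if e ∈ S t \ B t then ENNReal.ofReal (a e) else 0) ≤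
      ∑ s ∈ Finset.Icc 1 t, if e ∈ S s \ S (s - 1) then ENNReal.ofReal (a e) else 0 := by
    intro e t
    induction t with
    | zero => simp [hS.1]
    | succ t ih =>
      rw [Finset.sum_Icc_succ_top (by omega), Finset.sum_Icc_succ_top (by omega),
        Nat.add_sub_cancel]
      have hstep : ENNReal.ofReal (a e * y (t + 1) e) +
          (if e ∈ S (t + 1) \ B (t + 1) then ENNReal.ofReal (a e) else 0) ≤
          (if e ∈ S t \ B t then ENNReal.ofReal (a e) else 0) +
          (if e ∈ S (t + 1) \ S t then ENNReal.ofReal (a e) else 0) := by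
        have h1 := @hBS (t + 1) e
        have h2 := @hkeep t e
        simp only [hy, hz, Nat.add_sub_cancel, Set.mem_sdiff, Set.mem_inter_iff] at h2 ⊢
        by_cases b1 : e ∈ B t <;> by_cases b2 : e ∈ B (t + 1) <;>
          by_cases s1 : e ∈ S t <;> by_cases s2 : e ∈ S (t + 1) <;> simp_all
      calc _ = ∑ s ∈ Finset.Icc 1 t, ENNReal.ofReal (a e * y s e) +
            (ENNReal.ofReal (a e * y (t + 1) e) +
              (if e ∈ S (t + 1) \ B (t + 1) then ENNReal.ofReal (a e) else 0)) := by
            rw [add_assoc]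
        _ ≤ _ := (add_le_add_right hstep _)
        _ ≤ _ := by rw [← add_assoc]; exact add_le_add_left ih _
  rw [lpCost, msmCost, Finset.sum_add_distrib, add_comm]
  refine add_le_add (Finset.sum_le_sum fun t _ => Finset.sum_le_sum fun e _ => ?_) ?_
  · by_cases hb : e ∈ B t
    · simp [hz, hb, hBS t hb]
    · simp [hz, hb]
  · rw [Finset.sum_comm]
    conv_rhs => rw [Finset.sum_comm]
    exact Finset.sum_le_sum fun e _ => le_self_add.trans (hpot e T)

end Integral

/-! ### Auxiliary facts for the final bounds -/

lemma rho_eq_rankM {E : Type*} [Fintype E] {M : Matroid E} {a : E → ℝ} (hr : 1 ≤ rankM M)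
    (ha : ∀ e, 0 < a e) (hconst : ∀ e e', a e = a e') : rho M a = rankM M := by
  have := nonempty_of_one_le_rankM hr
  have hmin := aMin_pos ha
  have h : aMax a = aMin a := by
    refine le_antisymm (ciSup_le fun e => ?_) (aMin_le_aMax a)
    exact le_ciInf fun e' => (hconst e e').le
  rw [rho, h, mul_div_assoc, div_self hmin.ne', mul_one]

lemma log_eight_mul_le {x : ℝ} (hx : 2 ≤ x) : Real.log (8 * x) ≤ 4 * Real.log x := by
  have h : (4 : ℝ) * Real.log x = Real.log (x ^ 4) := by rw [Real.log_pow]; norm_num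
  rw [h]
  refine Real.log_le_log (by linarith) ?_
  have : (2 : ℝ) ^ 3 ≤ x ^ 3 := pow_le_pow_left₀ (by norm_num) hx 3
  nlinarith

lemma rounding_congr {E : Type*} [Fintype E] (M : Matroid E) (a : E → ℝ) (t : ℕ)
    (y z y' z' : ℕ → E → ℝ) (ω ω' : Seed E) (h : ∀ s ≤ t, y s = y' s ∧ z s = z' s)
    (hω : ∀ s ≤ t, ∀ k e, ω (s, k, e) = ω' (s, k, e)) :
    rounding M a y z ω t = rounding M a y' z' ω' t := by
  rw [rounding, rounding, thresholds_congr h hω, (h t le_rfl).2]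

lemma ae_isMSM {E : Type*} [Fintype E] {M : Matroid E} {a : E → ℝ} {T : ℕ} {y z : ℕ → E → ℝ}
    (hE : M.E = Set.univ) (hr : 1 ≤ rankM M) (ha : ∀ e, 0 < a e) (h : IsFractional M T y z) :
    ∀ᵐ ω ∂(seedLaw E), IsMSM M T (rounding M a y z ω) := by
  filter_upwards [ae_spanning hE hr ha h] with ω hω
  refine ⟨by simp [rounding], fun t ht => ?_⟩
  have := (Finset.mem_Icc.1 ht).1
  rw [rounding, if_neg (by omega)]
  exact hω t ht

end Multistage

end

theorem mainTheorem7 :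
    -- the algorithm is online: its choice at time `t` is determined by what is known at time `t`
    (∀ {E : Type*} [Fintype E] (M : Matroid E) (a : E → ℝ) (t : ℕ) (y z y' z' : ℕ → E → ℝ)
      (ω ω' : Multistage.Seed E),
      (∀ s ≤ t, y s = y' s ∧ z s = z' s) →
      (∀ s ≤ t, ∀ k e, ω (s, k, e) = ω' (s, k, e)) →
      Multistage.rounding M a y z ω t = Multistage.rounding M a y' z' ω' t) ∧
    ∃ C : ℝ, 0 < C ∧
      ∀ {E : Type*} [Fintype E] (M : Matroid E) (a : E → ℝ) (c : ℕ → E → ℝ≥0∞) (T : ℕ)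
        (y z : ℕ → E → ℝ),
        M.E = Set.univ → 1 ≤ Multistage.rankM M → (∀ e, 0 < a e) →
        Multistage.IsFractional M T y z →
        -- the output is a random solution
        (∀ t e, MeasurableSet {ω | e ∈ Multistage.rounding M a y z ω t}) ∧
        (∀ᵐ ω ∂(Multistage.seedLaw E), Multistage.IsMSM M T (Multistage.rounding M a y z ω)) ∧
        -- the loss of the rounding is `O(log R)`, which is `O(log (r · a_max / a_min))`
        Multistage.expectedCost M a c T y z ≤
          ENNReal.ofReal (C * Real.log (Multistage.bigR M a)) * Multistage.lpCost a c T y z ∧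
        (2 ≤ Multistage.rho M a →
          Multistage.expectedCost M a c T y z ≤
            ENNReal.ofReal (C * Real.log (Multistage.rho M a)) * Multistage.lpCost a c T y z) ∧
        -- uniform acquisition costs
        ((∀ e e', a e = a e') → 2 ≤ Multistage.rankM M →
          Multistage.expectedCost M a c T y z ≤
            ENNReal.ofReal (C * Real.log (Multistage.rankM M)) * Multistage.lpCost a c T y z) ∧
        -- an `α`-approximate fractional solution becomes an `O(α log R)`-approximate integral one
        (∀ α : ℝ≥0∞,
          (∀ y' z' : ℕ → E → ℝ, Multistage.IsFractional M T y' z' →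
            Multistage.lpCost a c T y z ≤ α * Multistage.lpCost a c T y' z') →
          ∀ S : ℕ → Set E, Multistage.IsMSM M T S →
            Multistage.expectedCost M a c T y z ≤
              ENNReal.ofReal (C * Real.log (Multistage.bigR M a)) *
                (α * Multistage.msmCost a c T S)) := by
  refine ⟨fun M a t y z y' z' ω ω' h hω => Multistage.rounding_congr M a t y z y' z' ω ω' h hω,
    1536, by norm_num, ?_⟩
  intro E _ M a c T y z hE hr ha h
  have hlog := Multistage.log_bigR_pos (M := M) hr ha
  have hsmall := Multistage.expectedCost_le hE hr ha h c
  rw [Multistage.bigL] at hsmall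
  have hR : Multistage.expectedCost M a c T y z ≤
      ENNReal.ofReal (1536 * Real.log (Multistage.bigR M a)) * Multistage.lpCost a c T y z :=
    hsmall.trans (mul_le_mul_left (ENNReal.ofReal_le_ofReal (by linarith)) _)
  have hrho : 2 ≤ Multistage.rho M a → Multistage.expectedCost M a c T y z ≤
      ENNReal.ofReal (1536 * Real.log (Multistage.rho M a)) * Multistage.lpCost a c T y z := by
    intro h2
    refine hsmall.trans (mul_le_mul_left (ENNReal.ofReal_le_ofReal ?_) _)
    have := Multistage.log_eight_mul_le h2
    rw [Multistage.bigR_eq]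
    linarith
  refine ⟨fun t e => Multistage.measurableSet_mem_rounding t e, Multistage.ae_isMSM hE hr ha h, hR,
    hrho, fun hconst h2 => ?_, fun α hα S hS => ?_⟩
  · rw [← Multistage.rho_eq_rankM hr ha hconst]
    refine hrho ?_
    rw [Multistage.rho_eq_rankM hr ha hconst]
    exact_mod_cast h2
  · obtain ⟨y', z', hfrac, hle⟩ := Multistage.exists_fractional_lpCost_le hE a c hS
    exact hR.trans (mul_le_mul_right ((hα y' z' hfrac).trans (mul_le_mul_right hle _)) _)
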